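/- Let $(M,\omega,\mathbb T)$ be a compact connected symplectic toric manifold of dimension $2m$ (the $m$-dimensional torus $\mathbb T$ acts smoothly, effectively and in a hamiltonian fashion) with moment map $\mu:M\to\mathfrak t^*$, normalised by $\omega(\xi^\sharp,\cdot)=-d\mu^\xi$, where $\xi^\sharp$ is the infinitesimal action of $\xi\in\mathfrak t$. Put $\Delta=\mu(M)$ and $\mathring M=\mu^{-1}(\mathring\Delta)$. Fix a basis $(\xi_j)$ of $\mathfrak t$, let $K_j=\xi_j^\sharp$, $\mu^j=\mu^{\xi_j}$, and let $\mathcal K=\mathrm{span}(K_1,\dots,K_m)$ on $\mathring M$. For an almost complex structure $J$ let $J^{*_\omega}$ be its symplectic adjoint, $\omega(J\cdot,\cdot)=\omega(\cdot,J^{*_\omega}\cdot)$. For a $\mathbb T$-invariant open set $U\subseteq M$, let $DGK^{\mathbb T}_\omega(U)$ be the set of smooth $\mathbb T$-invariant almost complex structures $J$ on $U$ that are $\omega$-tamed ($\omega(X,JX)>0$ for $X\neq 0$), for which both $J$ and $J^{*_\omega}$ are integrable (that is, $\mathbb T$-invariant generalized Kähler structures of symplectic type, regarded as tamed complex structures),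 and which satisfy $J^{*_\omega}\mathcal K=J\mathcal K$ on $U\cap\mathring M$. Let $K^{\mathbb T}_\omega(M)$ be the set of $\mathbb T$-invariant $\omega$-compatible complex structures on $M$. Let $(\mu^j,t^j)$ be admissible coordinates on $\mathring M$: there is $J\in DGK^{\mathbb T}_\omega(M)$ such that, near each point of $\mathring M$, the angular coordinates $t^j$ satisfy $dt^i(K_j)=\delta_{ij}$ and $dt^i(JK_j)=0$; thus $\partial/\partial t^j=K_j$, and the fields $\partial/\partial\mu^j$ and forms $dt^j$ are globally defined on $\mathring M$. Let $J_0\in K^{\mathbb T}_\omega(M)$ be, on $\mathring M$, of the form $$J_0=\sum_{i,j}S_{ij}\frac{\partial}{\partial t^i}\otimes d\mu^j-\sum_{i,j}(S^{-1})_{ij}\frac{\partial}{\partial\mu^i}\otimes dt^j$$ for a function $S$ on $\mathring M$ with values in the positive definite symmetric matrices, and let $C$ be a constant antisymmetric real $m\times m$ matrix. For $t\in\mathbb R$ put $\Psi(t)=S+tC$ and $$\mathring J_t=\sum_{i,j}\Psi_{ij}(t)\frac{\partial}{\partial t^i}\otimes d\mu^j-\sum_{i,j}(\Psi(t)^{-1})_{ij}\frac{\partial}{\partial\mu^i}\otimes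 dt^j .$$ Then $\mathring J_t\in DGK^{\mathbb T}_\omega(\mathring M)$ for all $t\in\mathbb R$, and there are $\varepsilon>0$ and a family $(J_t)_{|t|<\varepsilon}$ of elements of $DGK^{\mathbb T}_\omega(M)$, smooth in $(t,p)\in(-\varepsilon,\varepsilon)\times M$ and equal to the given $J_0$ at $t=0$, such that $J_t|_{\mathring M}=\mathring J_t$ for $|t|<\varepsilon$. If $C\ne0$, then $J_t\notin K^{\mathbb T}_\omega(M)$ for $0<|t|<\varepsilon$. -/

import Mathlib

open scoped Manifold ContDiff Topology
open Set Bundle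

noncomputable section

/-- The model space `ℝ^{2m}` of a real manifold of dimension `2m`. -/
abbrev Model (m : ℕ) : Type := EuclideanSpace ℝ (Fin (2 * m))

/-- The Lie algebra `𝔱 = ℝ^m` of the torus `𝕋 = (S¹)^m`. -/
abbrev TorusLie (m : ℕ) : Type := Fin m → ℝ

/-- The dual `𝔱^*` of the Lie algebra of the torus, a normed space. -/
abbrev TorusLieDual (m : ℕ) : Type := TorusLie m →L[ℝ] ℝ

/-- The torus `𝕋 = (S¹)^m` with its (pointwise) group structure. -/
abbrev Torus (m : ℕ) : Type := Fin m → Circle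

/-- The exponential map `𝔱 → 𝕋`, `v ↦ (e^{i v_1}, …, e^{i v_m})`. -/
def torusExp {m : ℕ} (v : TorusLie m) : Torus m := fun j => Circle.exp (v j)

section Tensors

variable {m : ℕ} {M : Type*} [TopologicalSpace M] [ChartedSpace (Model m) M]

/-- The tangent space of `M` at `p`. -/
abbrev TanSp (m : ℕ) {M : Type*} [TopologicalSpace M] [ChartedSpace (Model m) M] (p : M) : Type :=
  TangentSpace 𝓘(ℝ, Model m) p

/-- (Not necessarily continuous) vector fields. -/
abbrev VecField (m : ℕ) (M : Type*) [TopologicalSpace M] [ChartedSpace (Model m) M] :=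
  (p : M) → TanSp m p

/-- (Not necessarily continuous) fields of endomorphisms of the tangent bundle. -/
abbrev EndField (m : ℕ) (M : Type*) [TopologicalSpace M] [ChartedSpace (Model m) M] :=
  (p : M) → (TanSp m p →L[ℝ] TanSp m p)

/-- (Not necessarily continuous) fields of bilinear forms on the tangent bundle. -/
abbrev BilinField (m : ℕ) (M : Type*) [TopologicalSpace M] [ChartedSpace (Model m) M] :=
  (p : M) → (TanSp m p →L[ℝ] TanSp m p →L[ℝ] ℝ)

/-- The differential at `p` of a real-valued function. -/
def dfun (f : M → ℝ) (p : M) : TanSp m p →L[ℝ] ℝ :=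
  mfderiv 𝓘(ℝ, Model m) 𝓘(ℝ, ℝ) f p

/-- `X` is a smooth vector field on `U`. -/
def SmoothVecOn [IsManifold 𝓘(ℝ, Model m) ∞ M] (U : Set M) (X : VecField m M) : Prop :=
  ContMDiffOn 𝓘(ℝ, Model m) (𝓘(ℝ, Model m).tangent) ∞
    (fun p => (⟨p, X p⟩ : TangentBundle 𝓘(ℝ, Model m) M)) U

/-- `A` is a smooth section of `End(TM)` over `U`. -/
def SmoothEndOn [IsManifold 𝓘(ℝ, Model m) ∞ M] (U : Set M) (A : EndField m M) : Prop :=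
  ContMDiffOn 𝓘(ℝ, Model m) (𝓘(ℝ, Model m).prod 𝓘(ℝ, Model m →L[ℝ] Model m)) ∞
    (fun p => TotalSpace.mk' (Model m →L[ℝ] Model m)
      (E := fun p : M => TanSp m p →L[ℝ] TanSp m p) p (A p)) U

/-- `B` is a smooth section of `T^*M ⊗ T^*M`. -/
def SmoothBilin [IsManifold 𝓘(ℝ, Model m) ∞ M] (B : BilinField m M) : Prop :=
  ContMDiff 𝓘(ℝ, Model m) (𝓘(ℝ, Model m).prod 𝓘(ℝ, Model m →L[ℝ] Model m →L[ℝ] ℝ)) ∞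
    (fun p => TotalSpace.mk' (Model m →L[ℝ] Model m →L[ℝ] ℝ)
      (E := fun p : M => TanSp m p →L[ℝ] TanSp m p →L[ℝ] ℝ) p (B p))

/-- The Lie bracket of vector fields. -/
def bracket (X Y : VecField m M) : VecField m M :=
  VectorField.mlieBracket 𝓘(ℝ, Model m) X Y

/-- `dω = 0`, through the invariant formula for the exterior derivative of a 2-form. -/
def IsClosedTwoForm [IsManifold 𝓘(ℝ, Model m) ∞ M] (w : BilinField m M) : Prop :=
  ∀ X Y Z : VecField m M,
    SmoothVecOn univ X → SmoothVecOn univ Y → SmoothVecOn univ Z → ∀ p : M,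
      dfun (fun q => w q (Y q) (Z q)) p (X p)
        - dfun (fun q => w q (X q) (Z q)) p (Y p)
        + dfun (fun q => w q (X q) (Y q)) p (Z p)
        - w p (bracket X Y p) (Z p)
        + w p (bracket X Z p) (Y p)
        - w p (bracket Y Z p) (X p) = 0

/-- The Nijenhuis tensor `N_J(X,Y) = [JX,JY] - J[JX,Y] - J[X,JY] - [X,Y]` vanishes on the open
set `U`, i.e. the almost complex structure `J` is integrable on `U`. -/
def IntegrableOnSet [IsManifold 𝓘(ℝ, Model m) ∞ M] (U : Set M) (J : EndField m M) : Prop :=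
  ∀ X Y : VecField m M, SmoothVecOn U X → SmoothVecOn U Y → ∀ p ∈ U,
    bracket (fun q => J q (X q)) (fun q => J q (Y q)) p
      - J p (bracket (fun q => J q (X q)) Y p)
      - J p (bracket X (fun q => J q (Y q)) p)
      - bracket X Y p = 0

/-- `J` is a smooth almost complex structure on `U`. -/
def AlmostComplexOn [IsManifold 𝓘(ℝ, Model m) ∞ M] (U : Set M) (J : EndField m M) : Prop :=
  SmoothEndOn U J ∧ ∀ p ∈ U, ∀ X : TanSp m p, J p (J p X) = -X

end Tensors

/-- The value at `p` of the infinitesimal action `v^♯` on `M` of `v ∈ 𝔱`: the derivative at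
`0 ∈ 𝔱`, in the direction `v`, of `w ↦ exp(w) • p`. -/
def infAction {m : ℕ} {M : Type*} [TopologicalSpace M] [ChartedSpace (Model m) M]
    [MulAction (Torus m) M] (v : TorusLie m) (p : M) : TanSp m p :=
  (mfderiv 𝓘(ℝ, TorusLie m) 𝓘(ℝ, Model m) (fun w : TorusLie m => torusExp w • p) 0 v : Model m)

/-- The structure of a symplectic toric manifold on a manifold `M` of dimension `2m` endowed with
an action of the torus `𝕋` of dimension `m`. (Compactness and connectedness of `M` are required
separately.) -/
structure SymplecticToric (m : ℕ) (M : Type*) [TopologicalSpace M] [ChartedSpace (Model m) M]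
    [IsManifold 𝓘(ℝ, Model m) ∞ M] [MulAction (Torus m) M] where
  /-- the symplectic form -/
  sympl : BilinField m M
  sympl_smooth : SmoothBilin sympl
  sympl_alt : ∀ (p : M) (X : TanSp m p), sympl p X X = 0
  sympl_nondegenerate : ∀ (p : M) (X : TanSp m p), (∀ Y : TanSp m p, sympl p X Y = 0) → X = 0
  sympl_closed : IsClosedTwoForm sympl
  /-- The action is smooth (`exp : 𝔱 → 𝕋` is a surjective local diffeomorphism). -/
  action_smooth : ContMDiff (𝓘(ℝ, TorusLie m).prod 𝓘(ℝ, Model m)) 𝓘(ℝ, Model m) ∞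
    (fun q : TorusLie m × M => torusExp q.1 • q.2)
  action_effective : ∀ g : Torus m, (∀ p : M, g • p = p) → g = 1
  action_symplectic : ∀ (g : Torus m) (p : M) (X Y : TanSp m p),
    sympl (g • p) (mfderiv 𝓘(ℝ, Model m) 𝓘(ℝ, Model m) (fun q : M => g • q) p X)
      (mfderiv 𝓘(ℝ, Model m) 𝓘(ℝ, Model m) (fun q : M => g • q) p Y) = sympl p X Y
  /-- the moment map -/
  moment : M → TorusLieDual m
  moment_smooth : ContMDiff 𝓘(ℝ, Model m) 𝓘(ℝ, TorusLieDual m) ∞ moment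
  moment_invariant : ∀ (g : Torus m) (p : M), moment (g • p) = moment p
  /-- `v^♯` is the hamiltonian vector field `-ω⁻¹ dμ^v` of `μ^v = ⟨μ, v⟩`. -/
  moment_hamiltonian : ∀ (v : TorusLie m) (p : M) (X : TanSp m p),
    sympl p (infAction v p) X = -dfun (fun q => moment q v) p X

namespace SymplecticToric

variable {m : ℕ} {M : Type*} [TopologicalSpace M] [ChartedSpace (Model m) M]
  [IsManifold 𝓘(ℝ, Model m) ∞ M] [MulAction (Torus m) M]

/-- The moment polytope `Δ = μ(M) ⊆ 𝔱^*`. -/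
def polytope (T : SymplecticToric m M) : Set (TorusLieDual m) := range T.moment

/-- `M° = μ⁻¹(Δ°)`, where `Δ°` is the interior of the moment polytope. -/
def interiorPart (T : SymplecticToric m M) : Set M := T.moment ⁻¹' interior T.polytope

/-- `J` is invariant under `𝕋` at the points of the (invariant) set `U`. -/
def InvariantOn (_T : SymplecticToric m M) (U : Set M) (J : EndField m M) : Prop :=
  ∀ (g : Torus m), ∀ p ∈ U, ∀ X : TanSp m p,
    mfderiv 𝓘(ℝ, Model m) 𝓘(ℝ, Model m) (fun q : M => g • q) p (J p X)
      = J (g • p) (mfderiv 𝓘(ℝ, Model m) 𝓘(ℝ, Model m) (fun q : M => g • q) p X)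

/-- `J'` is the symplectic adjoint `J^{*_ω}` of `J` over `U`:
`ω(J·,·) = ω(·,J^{*_ω}·)` (by nondegeneracy it exists and is unique over `U`). -/
def IsAdjointOn (T : SymplecticToric m M) (U : Set M) (J J' : EndField m M) : Prop :=
  ∀ p ∈ U, ∀ X Y : TanSp m p, T.sympl p (J p X) Y = T.sympl p X (J' p Y)

/-- `J` is `ω`-tamed over `U`: the bilinear form `ω(·,J·)` is positive definite. -/
def TamedOn (T : SymplecticToric m M) (U : Set M) (J : EndField m M) : Prop :=
  ∀ p ∈ U, ∀ X : TanSp m p, X ≠ 0 → 0 < T.sympl p X (J p X)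

/-- The distribution `𝒦` generated by the action of `𝕋`. -/
def orbitDistribution (_T : SymplecticToric m M) (p : M) : Submodule ℝ (TanSp m p) :=
  Submodule.span ℝ (range fun v : TorusLie m => infAction v p)

/-- `K_ω^𝕋(M)`: the `𝕋`-invariant `ω`-compatible complex structures on `M`. -/
def IsKahler (T : SymplecticToric m M) (J : EndField m M) : Prop :=
  AlmostComplexOn univ J ∧ IntegrableOnSet univ J ∧ T.InvariantOn univ J ∧ T.TamedOn univ J ∧
    ∀ (p : M) (X Y : TanSp m p), T.sympl p (J p X) (J p Y) = T.sympl p X Y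

/-- `GK_ω^𝕋(U)` for a `𝕋`-invariant open set `U`: the `𝕋`-invariant generalized Kähler structures
of symplectic type on `U`, as `ω`-tamed almost complex structures `J` such that both `J` and its
symplectic adjoint `J^{*_ω}` are integrable. -/
def IsGKOn (T : SymplecticToric m M) (U : Set M) (J : EndField m M) : Prop :=
  AlmostComplexOn U J ∧ T.TamedOn U J ∧ T.InvariantOn U J ∧ IntegrableOnSet U J ∧
    ∃ J' : EndField m M, T.IsAdjointOn U J J' ∧ IntegrableOnSet U J'

/-- `DGK_ω^𝕋(U)` for a `𝕋`-invariant open set `U`: the `J ∈ GK_ω^𝕋(U)` such that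
`J^{*_ω} 𝒦 = J 𝒦` (over the part of `U` in `M°`, on which the distribution `𝒦` lives). -/
def IsDGKOn (T : SymplecticToric m M) (U : Set M) (J : EndField m M) : Prop :=
  T.IsGKOn U J ∧
    ∃ J' : EndField m M, T.IsAdjointOn U J J' ∧ ∀ p ∈ U ∩ T.interiorPart,
      (T.orbitDistribution p).map (J' p).toLinearMap =
        (T.orbitDistribution p).map (J p).toLinearMap

/-- Admissible coordinates `(μ^j, t^j)` on `M°`, for a fixed basis `ξ` of `𝔱`. They are induced by
some `J ∈ DGK_ω^𝕋(M)`: near each point of `M°`, the angular coordinates `t^j` complete functions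
`u^j` to `J`-holomorphic coordinates with `∂/∂u^j = -J K_j` and `∂/∂t^j = K_j`, where
`K_j = ξ_j^♯`, that is, `dt^i(K_j) = δ_ij` and `dt^i(J K_j) = 0` (and `du^i = dt^i ∘ J`). -/
structure AdmissibleCoords (T : SymplecticToric m M)
    (ξ : Module.Basis (Fin m) ℝ (TorusLie m)) where
  /-- the element of `DGK_ω^𝕋(M)` that induces the coordinates -/
  J : EndField m M
  J_mem : T.IsDGKOn univ J
  /-- `t p` is the system of angular coordinates used near `p` -/
  t : M → Fin m → M → ℝ
  t_spec : ∀ p ∈ T.interiorPart, ∃ U : Set M, IsOpen U ∧ p ∈ U ∧ U ⊆ T.interiorPart ∧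
    ∀ i, ContMDiffOn 𝓘(ℝ, Model m) 𝓘(ℝ, ℝ) ∞ (t p i) U ∧
      ∀ q ∈ U, ∀ j, dfun (t p i) q (infAction (ξ j) q) = (if i = j then 1 else 0) ∧
        dfun (t p i) q (J q (infAction (ξ j) q)) = 0
  /-- The coordinate fields `∂/∂μ^j` of the coordinate system `(μ^j, t^j)` on `M°`
  (the other ones are `∂/∂t^j = K_j`). -/
  dmuVec : Fin m → VecField m M
  dmuVec_spec : ∀ p ∈ T.interiorPart, ∀ i j,
    dfun (fun q => T.moment q (ξ i)) p (dmuVec j p) = (if i = j then 1 else 0) ∧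
      dfun (t p i) p (dmuVec j p) = 0

/-- The anti-diagonal field of endomorphisms
`∑ Ψ_ij ∂/∂t^i ⊗ dμ^j - ∑ (Ψ⁻¹)_ij ∂/∂μ^i ⊗ dt^j` on `M°` attached to a matrix-valued function `Ψ`
with invertible values on `M°`. Its values outside `M°` are meaningless. -/
def AdmissibleCoords.antiDiag {T : SymplecticToric m M}
    {ξ : Module.Basis (Fin m) ℝ (TorusLie m)} (c : T.AdmissibleCoords ξ)
    (Ψ : M → Matrix (Fin m) (Fin m) ℝ) : EndField m M := fun p =>
  ∑ i, ∑ j, Ψ p i j • (dfun (fun q => T.moment q (ξ j)) p).smulRight (infAction (ξ i) p)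
    - ∑ i, ∑ j, (Ψ p)⁻¹ i j • (dfun (c.t p j) p).smulRight (c.dmuVec i p)

end SymplecticToric

end

/-! ### The torus action: infinitesimal generators and invariant functions. -/

noncomputable section

set_option linter.unusedSectionVars false

variable {m : ℕ}

/-! The field A = ∑ C_ij K_i ⊗ dμ^j involves no angular coordinates, so it is defined, smooth and
𝕋-invariant on all of M. It squares to zero because dμ^j(K_i) = 0, and it is ω-selfadjoint because C
is antisymmetric. Put F_t = 1 - tAJ₀ and J_t = F_t J₀ F_t⁻¹ (`shearConj`, `deform`). On M° this is
the anti-diagonal structure of S + tC (`antiDiag_eq_deform`), so J_t is the required extension and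
no analysis near the boundary of the polytope is needed.

Pointwise linear algebra (`ShearData`): since F_t J₀ = J₀ + tA, and ω(X, AX) and ω(AX, AY) vanish,
ω(F_t X, F_t J₀X) = ω(X, J₀X). Hence F_t is invertible and J_t is tamed, for every t. Moreover
J_t^{*ω} = -J_{-t}, so the adjoint is integrable as soon as every J_t is. Both map 𝒦 onto J₀𝒦,
because A takes values in 𝒦 and kills 𝒦.

Integrability: for test fields F_t X and F_t Y, one needs a V such that the mixed brackets add up to
F_t V and the bracket of the images under J_t minus that of the fields is F_t J₀V
(`bracket_shear_integrable`). This uses only that N_{J₀} = 0, that the K_i commute, and that they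
preserve J₀ and the dμ^j. Invariance enters by identifying [v^♯, X] with the derivative of the
transport of X along orbits (`hasDerivAt_transport`).

If J_t were compatible with t ≠ 0, then A = 0 (`ShearData.shear_eq_zero`). This forces C = 0 at a
point where v ↦ v^♯ is injective. Effectiveness provides such a point
(`exists_infAction_injective`): by Baire some point is fixed by no nontrivial element of finite
order, and a lattice argument shows that the infinitesimal action is injective there. -/

theorem torusExp_zero : torusExp (0 : TorusLie m) = 1 := by
  funext j; simp [torusExp]

theorem torusExp_add (u v : TorusLie m) : torusExp (u + v) = torusExp u * torusExp v := by
  funext j; simp [torusExp, Circle.exp_add]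

theorem torusExp_surjective : Function.Surjective (torusExp (m := m)) := fun g =>
  ⟨fun j => Complex.arg (g j), funext fun j => Circle.exp_arg (g j)⟩

variable {M : Type*} [TopologicalSpace M] [ChartedSpace (Model m) M]
  [IsManifold 𝓘(ℝ, Model m) ∞ M] [MulAction (Torus m) M]

omit [IsManifold 𝓘(ℝ, Model m) ∞ M] [MulAction (Torus m) M] in
theorem tangentBundle_mk_eq {p q : M} (h : p = q) (X : TanSp m p) (Y : TanSp m q)
    (hXY : (show Model m from X) = Y) :
    (⟨p, X⟩ : TangentBundle 𝓘(ℝ, Model m) M) = ⟨q, Y⟩ := by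
  subst h; subst hXY; rfl

namespace SymplecticToric

theorem contMDiff_torusExp_smul (T : SymplecticToric m M) (p : M) :
    ContMDiff 𝓘(ℝ, TorusLie m) 𝓘(ℝ, Model m) ∞ (fun w : TorusLie m => torusExp w • p) :=
  T.action_smooth.comp (contMDiff_id.prodMk contMDiff_const)

theorem contMDiff_smul (T : SymplecticToric m M) (g : Torus m) :
    ContMDiff 𝓘(ℝ, Model m) 𝓘(ℝ, Model m) ∞ (fun q : M => g • q) := by
  obtain ⟨u, rfl⟩ := torusExp_surjective g
  exact T.action_smooth.comp (contMDiff_const.prodMk contMDiff_id)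

theorem mdifferentiable_smul (T : SymplecticToric m M) (g : Torus m) :
    MDifferentiable 𝓘(ℝ, Model m) 𝓘(ℝ, Model m) (fun q : M => g • q) :=
  (T.contMDiff_smul g).mdifferentiable (by simp)

/-- The infinitesimal action is linear in the Lie algebra element. -/
def infActionL (p : M) : TorusLie m →L[ℝ] TanSp m p :=
  (show TorusLie m →L[ℝ] Model m from
    mfderiv 𝓘(ℝ, TorusLie m) 𝓘(ℝ, Model m) (fun w : TorusLie m => torusExp w • p) 0)

theorem infActionL_apply (p : M) (v : TorusLie m) : infActionL p v = infAction v p := rfl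

/-- The torus is abelian, so g commutes with the one-parameter groups and no adjoint action appears.
-/
theorem infAction_smul (T : SymplecticToric m M) (v : TorusLie m) (g : Torus m) (p : M) :
    infAction v (g • p) =
      mfderiv 𝓘(ℝ, Model m) 𝓘(ℝ, Model m) (fun q : M => g • q) p (infAction v p) := by
  have h0 : torusExp (0 : TorusLie m) • p = p := by simp [torusExp_zero]
  have h1 := mfderiv_comp_apply_of_eq (I := 𝓘(ℝ, TorusLie m)) (f := fun w : TorusLie m => torusExp w • p) 0
    (T.mdifferentiable_smul g p) ((T.contMDiff_torusExp_smul p).mdifferentiable (by simp) 0) h0 v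
  unfold infAction
  have h2 : (fun q : M => g • q) ∘ (fun w : TorusLie m => torusExp w • p) =
      fun w => torusExp w • g • p := by
    funext w; simp only [Function.comp, ← mul_smul, mul_comm]
  rw [h2] at h1
  exact h1

/-- The field is the tangent map of the action applied to the smooth section p ↦ ((0, v), (p, 0)).
-/
theorem infAction_smooth (T : SymplecticToric m M) (v : TorusLie m) :
    SmoothVecOn univ (fun p : M => infAction v p) := by
  have : IsManifold 𝓘(ℝ, Model m) 1 M := .of_le (n := ∞) (by simp)
  have h1 : ContMDiff 𝓘(ℝ, Model m) 𝓘(ℝ, TorusLie m).tangent ∞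
      (fun _ : M => (⟨0, v⟩ : TangentBundle 𝓘(ℝ, TorusLie m) (TorusLie m))) := contMDiff_const
  have h2 : ContMDiff 𝓘(ℝ, Model m) 𝓘(ℝ, Model m).tangent ∞
      (fun p : M => (⟨p, 0⟩ : TangentBundle 𝓘(ℝ, Model m) M)) :=
    contMDiff_zeroSection ℝ (TangentSpace 𝓘(ℝ, Model m) : M → Type _)
  have h3 := (T.action_smooth.contMDiff_tangentMap (m := ∞) (by simp)).comp
    (contMDiff_equivTangentBundleProd_symm.comp (h1.prodMk h2))
  refine ContMDiff.contMDiffOn (h3.congr fun p => ?_)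
  have h0 : torusExp (0 : TorusLie m) • p = p := by simp [torusExp_zero]
  simp only [Function.comp, tangentMap]
  refine (tangentBundle_mk_eq h0 _ _ ?_).symm
  have h4 := mfderiv_comp_apply (I := 𝓘(ℝ, TorusLie m)) (I' := 𝓘(ℝ, TorusLie m).prod 𝓘(ℝ, Model m))
    (f := fun w : TorusLie m => (w, p)) (g := fun q : TorusLie m × M => torusExp q.1 • q.2) 0
    (T.action_smooth.mdifferentiable (by simp) (0, p))
    ((contMDiff_id.prodMk contMDiff_const).mdifferentiable (n := ∞) (by simp) 0) v
  rw [mfderiv_prod_left] at h4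
  exact h4.symm

theorem contMDiff_moment (T : SymplecticToric m M) (v : TorusLie m) :
    ContMDiff 𝓘(ℝ, Model m) 𝓘(ℝ, ℝ) ∞ (fun q => T.moment q v) :=
  ((ContinuousLinearMap.apply ℝ ℝ v).contDiff.contMDiff).comp T.moment_smooth

/-- Invariant functions have invariant differentials. -/
theorem dfun_smul (T : SymplecticToric m M) {f : M → ℝ} (hf : ContMDiff 𝓘(ℝ, Model m) 𝓘(ℝ, ℝ) ∞ f)
    (hinv : ∀ (g : Torus m) p, f (g • p) = f p) (g : Torus m) (p : M) (X : TanSp m p) :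
    dfun f (g • p) (mfderiv 𝓘(ℝ, Model m) 𝓘(ℝ, Model m) (fun q : M => g • q) p X) = dfun f p X := by
  have h1 := mfderiv_comp_apply p (hf.mdifferentiable (by simp) (g • p)) (T.mdifferentiable_smul g p) X
  have h2 : f ∘ (fun q : M => g • q) = f := by funext q; simp [hinv]
  rw [h2] at h1
  exact h1.symm

theorem dfun_infAction (T : SymplecticToric m M) {f : M → ℝ}
    (hf : ContMDiff 𝓘(ℝ, Model m) 𝓘(ℝ, ℝ) ∞ f)
    (hinv : ∀ (g : Torus m) p, f (g • p) = f p) (v : TorusLie m) (p : M) :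
    dfun f p (infAction v p) = 0 := by
  have h0 : torusExp (0 : TorusLie m) • p = p := by simp [torusExp_zero]
  have h1 := mfderiv_comp_apply_of_eq (I := 𝓘(ℝ, TorusLie m)) (f := fun w : TorusLie m => torusExp w • p) 0
    (hf.mdifferentiable (by simp) p) ((T.contMDiff_torusExp_smul p).mdifferentiable (by simp) 0) h0 v
  have h2 : f ∘ (fun w : TorusLie m => torusExp w • p) = fun _ => f p := by
    funext q; simp [hinv]
  rw [h2, mfderiv_const] at h1
  exact h1.symm

end SymplecticToric
end

/-! ### Vector fields and brackets read in charts. -/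

noncomputable section

set_option linter.unusedSectionVars false

variable {m : ℕ} {M : Type*} [TopologicalSpace M] [ChartedSpace (Model m) M]

/-- The representation of a vector field in the preferred chart at `p`. -/
def chartField (p : M) (X : VecField m M) (y : Model m) : Model m :=
  VectorField.mpullback 𝓘(ℝ, Model m) 𝓘(ℝ, Model m) (extChartAt 𝓘(ℝ, Model m) p).symm X y

variable [IsManifold 𝓘(ℝ, Model m) ∞ M]

theorem bracket_eq_chart (p : M) (X Y : VecField m M) :
    bracket X Y p = (mfderiv 𝓘(ℝ, Model m) 𝓘(ℝ, Model m) (extChartAt 𝓘(ℝ, Model m) p) p).inverse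
      (VectorField.lieBracket ℝ (chartField p X) (chartField p Y)
        (extChartAt 𝓘(ℝ, Model m) p p)) := by
  have : IsManifold 𝓘(ℝ, Model m) 1 M := .of_le (n := ∞) (by simp)
  unfold bracket chartField
  rw [VectorField.mlieBracket, VectorField.mlieBracketWithin_apply]
  simp only [modelWithCornersSelf_coe, range_id, preimage_univ, univ_inter,
    VectorField.mpullbackWithin_univ]
  exact congrArg _ (congrFun VectorField.lieBracketWithin_univ _)

theorem contDiffAt_chartField {p : M} {X : VecField m M} {U : Set M} (hU : U ∈ 𝓝 p)
    (hX : SmoothVecOn U X) :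
    ContDiffAt ℝ ∞ (chartField p X) (extChartAt 𝓘(ℝ, Model m) p p) := by
  have hXp := (hX p (mem_of_mem_nhds hU)).contMDiffAt hU
  have h := VectorField.contMDiffWithinAt_mpullbackWithin_extChartAt_symm (n := ∞) (m := ∞)
    hXp.contMDiffWithinAt uniqueMDiffOn_univ (mem_univ p) (by simp)
  simp only [modelWithCornersSelf_coe, range_id, preimage_univ, inter_univ,
    VectorField.mpullbackWithin_univ] at h
  have h2 := h.contMDiffAt (extChartAt_target_mem_nhds p)
  exact contMDiffAt_vectorSpace_iff_contDiffAt.1 h2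

theorem chartField_apply {p : M} (X : VecField m M) {y : Model m}
    (hy : y ∈ (extChartAt 𝓘(ℝ, Model m) p).target) :
    X ((extChartAt 𝓘(ℝ, Model m) p).symm y) =
      mfderiv 𝓘(ℝ, Model m) 𝓘(ℝ, Model m) (extChartAt 𝓘(ℝ, Model m) p).symm y
        (chartField p X y) := by
  have : IsManifold 𝓘(ℝ, Model m) 1 M := .of_le (n := ∞) (by simp)
  have h := isInvertible_mfderivWithin_extChartAt_symm (I := 𝓘(ℝ, Model m)) hy
  simp only [modelWithCornersSelf_coe, range_id, mfderivWithin_univ] at h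
  obtain ⟨L, hL⟩ := h
  unfold chartField
  rw [VectorField.mpullback_apply, ← hL, ContinuousLinearMap.inverse_equiv]
  exact (L.apply_symm_apply _).symm

theorem chartField_eq {p : M} (X : VecField m M) {y : Model m}
    (hy : y ∈ (extChartAt 𝓘(ℝ, Model m) p).target) :
    chartField p X y = mfderiv 𝓘(ℝ, Model m) 𝓘(ℝ, Model m) (extChartAt 𝓘(ℝ, Model m) p)
      ((extChartAt 𝓘(ℝ, Model m) p).symm y) (X ((extChartAt 𝓘(ℝ, Model m) p).symm y)) := by
  have : IsManifold 𝓘(ℝ, Model m) 1 M := .of_le (n := ∞) (by simp)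
  have h := mfderiv_extChartAt_comp_mfderivWithin_extChartAt_symm (I := 𝓘(ℝ, Model m)) hy
  simp only [modelWithCornersSelf_coe, range_id, mfderivWithin_univ] at h
  rw [chartField_apply X hy]
  exact (DFunLike.congr_fun h (chartField p X y)).symm

theorem mdifferentiableAt_extChartAt_symm {p : M} {y : Model m}
    (hy : y ∈ (extChartAt 𝓘(ℝ, Model m) p).target) :
    MDifferentiableAt 𝓘(ℝ, Model m) 𝓘(ℝ, Model m) (extChartAt 𝓘(ℝ, Model m) p).symm y := by
  have h := (contMDiffOn_extChartAt_symm (I := 𝓘(ℝ, Model m)) (n := ∞) p).mdifferentiableOn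
    (by simp) y hy
  exact h.mdifferentiableAt ((isOpen_extChartAt_target p).mem_nhds hy)

/-- The derivative of a function along a vector field, read in a chart. -/
theorem dfun_chart {p : M} {f : M → ℝ} {y : Model m}
    (hy : y ∈ (extChartAt 𝓘(ℝ, Model m) p).target)
    (hf : MDifferentiableAt 𝓘(ℝ, Model m) 𝓘(ℝ, ℝ) f ((extChartAt 𝓘(ℝ, Model m) p).symm y))
    (X : VecField m M) :
    dfun f ((extChartAt 𝓘(ℝ, Model m) p).symm y) (X ((extChartAt 𝓘(ℝ, Model m) p).symm y)) =
      fderiv ℝ (f ∘ (extChartAt 𝓘(ℝ, Model m) p).symm) y (chartField p X y) := by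
  rw [chartField_apply X hy]
  have h1 := mfderiv_comp_apply y hf (mdifferentiableAt_extChartAt_symm hy) (chartField p X y)
  rw [mfderiv_eq_fderiv] at h1
  exact h1.symm

theorem dfun_eq_fderiv_chart {p : M} {f : M → ℝ}
    (hf : MDifferentiableAt 𝓘(ℝ, Model m) 𝓘(ℝ, ℝ) f p) (X : VecField m M) :
    dfun f p (X p) = fderiv ℝ (f ∘ (extChartAt 𝓘(ℝ, Model m) p).symm)
      (extChartAt 𝓘(ℝ, Model m) p p) (chartField p X (extChartAt 𝓘(ℝ, Model m) p p)) := by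
  have h := dfun_chart (mem_extChartAt_target p) (f := f) (by simpa using hf) X
  rw [extChartAt_to_inv] at h
  exact h

theorem dfun_eq_fderiv_mfderiv_extChartAt {p : M} {f : M → ℝ}
    (hf : MDifferentiableAt 𝓘(ℝ, Model m) 𝓘(ℝ, ℝ) f p) (w : TanSp m p) :
    dfun f p w = fderiv ℝ (f ∘ (extChartAt 𝓘(ℝ, Model m) p).symm) (extChartAt 𝓘(ℝ, Model m) p p)
      (mfderiv 𝓘(ℝ, Model m) 𝓘(ℝ, Model m) (extChartAt 𝓘(ℝ, Model m) p) p w) := by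
  have : IsManifold 𝓘(ℝ, Model m) 1 M := .of_le (n := ∞) (by simp)
  have hs := mdifferentiableAt_extChartAt_symm (mem_extChartAt_target (I := 𝓘(ℝ, Model m)) p)
  have hg : MDifferentiableAt 𝓘(ℝ, Model m) 𝓘(ℝ, ℝ) (f ∘ (extChartAt 𝓘(ℝ, Model m) p).symm)
      (extChartAt 𝓘(ℝ, Model m) p p) :=
    MDifferentiableAt.comp _ (by simpa using hf) hs
  have he : MDifferentiableAt 𝓘(ℝ, Model m) 𝓘(ℝ, Model m) (extChartAt 𝓘(ℝ, Model m) p) p :=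
    mdifferentiableAt_extChartAt (mem_chart_source _ p)
  have h1 := mfderiv_comp_apply p hg he w
  rw [mfderiv_eq_fderiv] at h1
  refine Eq.trans ?_ h1
  have h2 : f =ᶠ[𝓝 p] (f ∘ (extChartAt 𝓘(ℝ, Model m) p).symm) ∘ extChartAt 𝓘(ℝ, Model m) p := by
    filter_upwards [extChartAt_source_mem_nhds (I := 𝓘(ℝ, Model m)) p] with q hq
    simp [-extChartAt, (extChartAt 𝓘(ℝ, Model m) p).left_inv hq]
  unfold dfun
  rw [h2.mfderiv_eq]
  rfl

theorem mfderiv_extChartAt_bracket (p : M) (X Y : VecField m M) :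
    mfderiv 𝓘(ℝ, Model m) 𝓘(ℝ, Model m) (extChartAt 𝓘(ℝ, Model m) p) p (bracket X Y p) =
      VectorField.lieBracket ℝ (chartField p X) (chartField p Y)
        (extChartAt 𝓘(ℝ, Model m) p p) := by
  have : IsManifold 𝓘(ℝ, Model m) 1 M := .of_le (n := ∞) (by simp)
  rw [bracket_eq_chart]
  obtain ⟨L, hL⟩ := isInvertible_mfderiv_extChartAt
    (mem_extChartAt_source (I := 𝓘(ℝ, Model m)) p)
  rw [← hL, ContinuousLinearMap.inverse_equiv]
  exact L.apply_symm_apply _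

theorem contMDiffOn_dfun {f : M → ℝ} {U : Set M} (hf : ContMDiff 𝓘(ℝ, Model m) 𝓘(ℝ, ℝ) ∞ f)
    {X : VecField m M} (hX : SmoothVecOn U X) :
    ContMDiffOn 𝓘(ℝ, Model m) 𝓘(ℝ, ℝ) ∞ (fun q => dfun f q (X q)) U := by
  have : IsManifold 𝓘(ℝ, Model m) 1 M := .of_le (n := ∞) (by simp)
  have h1 : ContMDiff _ _ _ _ := hf.contMDiff_tangentMap (m := ∞) (by simp)
  exact (contMDiff_snd_tangentBundle_modelSpace ℝ 𝓘(ℝ, ℝ)).comp_contMDiffOn (h1.comp_contMDiffOn hX)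

theorem contMDiff_dfun {f : M → ℝ} (hf : ContMDiff 𝓘(ℝ, Model m) 𝓘(ℝ, ℝ) ∞ f)
    {X : VecField m M} (hX : SmoothVecOn univ X) :
    ContMDiff 𝓘(ℝ, Model m) 𝓘(ℝ, ℝ) ∞ (fun q => dfun f q (X q)) :=
  contMDiffOn_univ.1 (contMDiffOn_dfun hf hX)

/-- The Lie bracket is the commutator of derivations. -/
theorem dfun_bracket {f : M → ℝ} (hf : ContMDiff 𝓘(ℝ, Model m) 𝓘(ℝ, ℝ) ∞ f)
    {X Y : VecField m M} (hX : SmoothVecOn univ X) (hY : SmoothVecOn univ Y) (p : M) :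
    dfun f p (bracket X Y p) =
      dfun (fun q => dfun f q (Y q)) p (X p) - dfun (fun q => dfun f q (X q)) p (Y p) := by
  have hfd := hf.mdifferentiable (by simp)
  have key : ∀ Z : VecField m M, (fun q => dfun f q (Z q)) ∘ (extChartAt 𝓘(ℝ, Model m) p).symm
      =ᶠ[𝓝 (extChartAt 𝓘(ℝ, Model m) p p)]
      fun y => fderiv ℝ (f ∘ (extChartAt 𝓘(ℝ, Model m) p).symm) y (chartField p Z y) := by
    intro Z
    filter_upwards [extChartAt_target_mem_nhds p] with y hy
    exact dfun_chart hy (hfd _) Z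
  rw [dfun_eq_fderiv_mfderiv_extChartAt (hfd p), mfderiv_extChartAt_bracket,
    dfun_eq_fderiv_chart ((contMDiff_dfun hf hY).mdifferentiable (by simp) p),
    dfun_eq_fderiv_chart ((contMDiff_dfun hf hX).mdifferentiable (by simp) p),
    (key X).fderiv_eq, (key Y).fderiv_eq]
  have hfc : ContDiffAt ℝ ∞ (f ∘ (extChartAt 𝓘(ℝ, Model m) p).symm)
      (extChartAt 𝓘(ℝ, Model m) p p) :=
    ((hf.comp_contMDiffOn (contMDiffOn_extChartAt_symm (n := ∞) p)).contMDiffAt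
      (extChartAt_target_mem_nhds p)).contDiffAt
  exact VectorField.fderiv_apply_lieBracket hfc
    (by rw [minSmoothness_of_isRCLikeNormedField]; exact ENat.LEInfty.out)
    ((contDiffAt_chartField Filter.univ_mem hY).differentiableAt (by simp))
    ((contDiffAt_chartField Filter.univ_mem hX).differentiableAt (by simp))
end

/-! ### The bracket with a generator as a Lie derivative. -/

noncomputable section

set_option linter.unusedSectionVars false

variable {m : ℕ} {M : Type*} [TopologicalSpace M] [ChartedSpace (Model m) M]
  [IsManifold 𝓘(ℝ, Model m) ∞ M] [MulAction (Torus m) M]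

namespace SymplecticToric

/-- The action of `exp u` read in the preferred chart at `p`. -/
def chartAction (p : M) (u : TorusLie m × Model m) : Model m :=
  extChartAt 𝓘(ℝ, Model m) p (torusExp u.1 • (extChartAt 𝓘(ℝ, Model m) p).symm u.2)

theorem contDiffAt_chartAction (T : SymplecticToric m M) (p : M) :
    ContDiffAt ℝ ∞ (chartAction p) (0, extChartAt 𝓘(ℝ, Model m) p p) := by
  have h1 : ContMDiffAt 𝓘(ℝ, TorusLie m × Model m) 𝓘(ℝ, TorusLie m) ∞
      (fun u : TorusLie m × Model m => u.1) (0, extChartAt 𝓘(ℝ, Model m) p p) :=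
    contDiff_fst.contMDiff _
  have h2 : ContMDiffAt 𝓘(ℝ, TorusLie m × Model m) 𝓘(ℝ, Model m) ∞
      (fun u : TorusLie m × Model m => (extChartAt 𝓘(ℝ, Model m) p).symm u.2)
      (0, extChartAt 𝓘(ℝ, Model m) p p) :=
    ContMDiffAt.comp (g := (extChartAt 𝓘(ℝ, Model m) p).symm) _
      ((contMDiffOn_extChartAt_symm (n := ∞) p).contMDiffAt
        (show (extChartAt 𝓘(ℝ, Model m) p).target ∈ 𝓝 (extChartAt 𝓘(ℝ, Model m) p p) from
          extChartAt_target_mem_nhds p))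
      (contDiff_snd.contMDiff _)
  have h3 := (T.action_smooth _).comp _ (h1.prodMk h2)
  have h4 : ContMDiffAt 𝓘(ℝ, Model m) 𝓘(ℝ, Model m) ∞ (extChartAt 𝓘(ℝ, Model m) p)
      (torusExp (0 : TorusLie m) • (extChartAt 𝓘(ℝ, Model m) p).symm
        (extChartAt 𝓘(ℝ, Model m) p p)) := by
    rw [extChartAt_to_inv, torusExp_zero, one_smul]
    exact contMDiffAt_extChartAt
  exact (ContMDiffAt.comp (g := extChartAt 𝓘(ℝ, Model m) p)
    ((0 : TorusLie m), extChartAt 𝓘(ℝ, Model m) p p) h4 h3).contDiffAt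

theorem chartAction_zero {p : M} {y : Model m} (hy : y ∈ (extChartAt 𝓘(ℝ, Model m) p).target) :
    chartAction p (0, y) = y := by
  simp only [chartAction, torusExp_zero, one_smul]
  exact (extChartAt 𝓘(ℝ, Model m) p).right_inv hy

theorem eventually_differentiableAt_chartAction (T : SymplecticToric m M) (p : M) :
    ∀ᶠ u in 𝓝 ((0 : TorusLie m), extChartAt 𝓘(ℝ, Model m) p p),
      DifferentiableAt ℝ (chartAction p) u :=
  (((T.contDiffAt_chartAction p).of_le (m := 1) ENat.LEInfty.out).eventually (by simp)).mono
    fun _ hx => hx.differentiableAt (by simp)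

/-- The infinitesimal action read in a chart. -/
theorem chartField_infAction (T : SymplecticToric m M) (v : TorusLie m) (p : M) :
    chartField p (fun q => infAction v q) =ᶠ[𝓝 (extChartAt 𝓘(ℝ, Model m) p p)]
      fun y => fderiv ℝ (chartAction p) (0, y) (v, 0) := by
  have hc : Filter.Tendsto (fun y : Model m => ((0 : TorusLie m), y))
      (𝓝 (extChartAt 𝓘(ℝ, Model m) p p)) (𝓝 (0, extChartAt 𝓘(ℝ, Model m) p p)) :=
    (Continuous.prodMk_right 0).continuousAt
  filter_upwards [extChartAt_target_mem_nhds p,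
    hc.eventually (T.eventually_differentiableAt_chartAction p)] with y hy hd
  rw [chartField_eq _ hy]
  have h0 : torusExp (0 : TorusLie m) • (extChartAt 𝓘(ℝ, Model m) p).symm y =
    (extChartAt 𝓘(ℝ, Model m) p).symm y := by simp [torusExp_zero]
  have h1 := mfderiv_comp_apply_of_eq (I := 𝓘(ℝ, TorusLie m))
    (f := fun w : TorusLie m => torusExp w • (extChartAt 𝓘(ℝ, Model m) p).symm y) 0
    (mdifferentiableAt_extChartAt (I := 𝓘(ℝ, Model m))
      (by simpa using (extChartAt 𝓘(ℝ, Model m) p).map_target hy))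
    ((T.contMDiff_torusExp_smul _).mdifferentiable (by simp) 0) h0 v
  refine h1.symm.trans ?_
  rw [mfderiv_eq_fderiv]
  have h2 : HasFDerivAt (fun u : TorusLie m => chartAction p (u, y)) _ 0 :=
    HasFDerivAt.comp (g := chartAction p) (0 : TorusLie m) hd.hasFDerivAt
      (hasFDerivAt_prodMk_left 0 y)
  have h3 := DFunLike.congr_fun h2.fderiv v
  simp only [ContinuousLinearMap.comp_apply, ContinuousLinearMap.inl_apply] at h3
  exact h3

/-- The transport to `p` of the value of the vector field `X` along the orbit of `p`. -/
def transport (v : TorusLie m) (X : VecField m M) (p : M) (s : ℝ) : Model m :=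
  mfderiv 𝓘(ℝ, Model m) 𝓘(ℝ, Model m) (fun q : M => torusExp (-(s • v)) • q) (torusExp (s • v) • p)
    (X (torusExp (s • v) • p))

theorem mfderiv_extChartAt_mfderiv_smul (T : SymplecticToric m M) (X : VecField m M) {p : M}
    {g : Torus m} {y : Model m} (hy : y ∈ (extChartAt 𝓘(ℝ, Model m) p).target)
    (hg : g • (extChartAt 𝓘(ℝ, Model m) p).symm y = p) :
    mfderiv 𝓘(ℝ, Model m) 𝓘(ℝ, Model m) (extChartAt 𝓘(ℝ, Model m) p) p
      (mfderiv 𝓘(ℝ, Model m) 𝓘(ℝ, Model m) (fun q : M => g • q)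
        ((extChartAt 𝓘(ℝ, Model m) p).symm y) (X ((extChartAt 𝓘(ℝ, Model m) p).symm y)) : Model m) =
    fderiv ℝ (fun y => extChartAt 𝓘(ℝ, Model m) p (g • (extChartAt 𝓘(ℝ, Model m) p).symm y)) y
      (chartField p X y) := by
  have he : MDifferentiableAt 𝓘(ℝ, Model m) 𝓘(ℝ, Model m) (extChartAt 𝓘(ℝ, Model m) p) p :=
    mdifferentiableAt_extChartAt (mem_chart_source _ p)
  have h1 := mfderiv_comp_apply_of_eq (f := fun q : M => g • q) _ he (T.mdifferentiable_smul g _) hg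
    (X ((extChartAt 𝓘(ℝ, Model m) p).symm y))
  refine h1.symm.trans ?_
  rw [chartField_apply X hy]
  have h2 := mfderiv_comp_apply y (f := (extChartAt 𝓘(ℝ, Model m) p).symm)
    (g := (extChartAt 𝓘(ℝ, Model m) p) ∘ fun q : M => g • q)
    (MDifferentiableAt.comp_of_eq _ he (T.mdifferentiable_smul g _) hg)
    (mdifferentiableAt_extChartAt_symm hy) (chartField p X y)
  rw [mfderiv_eq_fderiv] at h2
  exact h2.symm

/-- Holds only for small s, while the orbit stays in the chart at p; this suffices for a derivative
at 0. -/
theorem mfderiv_transport (T : SymplecticToric m M) (v : TorusLie m) (X : VecField m M) (p : M) :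
    (fun s => mfderiv 𝓘(ℝ, Model m) 𝓘(ℝ, Model m) (extChartAt 𝓘(ℝ, Model m) p) p
      (transport v X p s)) =ᶠ[𝓝 (0 : ℝ)] fun s =>
      fderiv ℝ (chartAction p) (-(s • v), chartAction p (s • v, extChartAt 𝓘(ℝ, Model m) p p))
        (0, chartField p X (chartAction p (s • v, extChartAt 𝓘(ℝ, Model m) p p))) := by
  have hc1 : ContinuousAt (fun s : ℝ => torusExp (s • v) • p) 0 :=
    ((T.contMDiff_torusExp_smul p).continuous.comp (continuous_id.smul continuous_const)).continuousAt
  have hev1 : ∀ᶠ s in 𝓝 (0 : ℝ), torusExp (s • v) • p ∈ (extChartAt 𝓘(ℝ, Model m) p).source := by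
    refine hc1 ?_
    simp only [zero_smul, torusExp_zero, one_smul]
    exact extChartAt_source_mem_nhds p
  have hc2 : ContinuousAt
      (fun s : ℝ => (-(s • v), chartAction p (s • v, extChartAt 𝓘(ℝ, Model m) p p))) 0 := by
    refine ContinuousAt.prodMk (by fun_prop) ?_
    refine ContinuousAt.comp (x := (0 : ℝ)) (f := fun s : ℝ => (s • v, extChartAt 𝓘(ℝ, Model m) p p))
      (g := chartAction p) ?_
      (by fun_prop)
    simpa using (T.contDiffAt_chartAction p).continuousAt
  have hev2 : ∀ᶠ s in 𝓝 (0 : ℝ), DifferentiableAt ℝ (chartAction p)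
      (-(s • v), chartAction p (s • v, extChartAt 𝓘(ℝ, Model m) p p)) := by
    refine hc2.eventually ?_
    simp only [zero_smul, neg_zero, chartAction_zero (mem_extChartAt_target p)]
    exact T.eventually_differentiableAt_chartAction p
  filter_upwards [hev1, hev2] with s hs hd
  have hy0 : chartAction p (s • v, extChartAt 𝓘(ℝ, Model m) p p) =
      extChartAt 𝓘(ℝ, Model m) p (torusExp (s • v) • p) := by
    simp only [chartAction, extChartAt_to_inv]
  have hy : chartAction p (s • v, extChartAt 𝓘(ℝ, Model m) p p) ∈
      (extChartAt 𝓘(ℝ, Model m) p).target := by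
    rw [hy0]; exact (extChartAt 𝓘(ℝ, Model m) p).map_source hs
  have hq : (extChartAt 𝓘(ℝ, Model m) p).symm
      (chartAction p (s • v, extChartAt 𝓘(ℝ, Model m) p p)) = torusExp (s • v) • p := by
    rw [hy0]; exact (extChartAt 𝓘(ℝ, Model m) p).left_inv hs
  generalize chartAction p (s • v, extChartAt 𝓘(ℝ, Model m) p p) = y at *
  have hg : torusExp (-(s • v)) • (extChartAt 𝓘(ℝ, Model m) p).symm y = p := by
    rw [hq, ← mul_smul, ← torusExp_add]; simp [torusExp_zero]
  unfold transport
  rw [← hq, T.mfderiv_extChartAt_mfderiv_smul X hy hg]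
  have h2 : HasFDerivAt (fun z : Model m => chartAction p (-(s • v), z)) _ y :=
    HasFDerivAt.comp (g := chartAction p) y hd.hasFDerivAt (hasFDerivAt_prodMk_right _ y)
  have h3 := DFunLike.congr_fun h2.fderiv (chartField p X y)
  simpa using! h3

/-- The product rule at s = 0 gives DY(K) plus the second derivative of Θ in the directions (-v, K)
and (0, Y). Its purely spatial part vanishes, and by symmetry the rest is -DK(Y). Only Θ(0, ·) = id
is used, not the group law. -/
theorem chart_lieDerivative {V E : Type*} [NormedAddCommGroup V] [NormedSpace ℝ V]
    [NormedAddCommGroup E] [NormedSpace ℝ E] {Θ : V × E → E} {y₀ : E} {v : V}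
    (hΘ : ContDiffAt ℝ ∞ Θ (0, y₀)) (h0 : ∀ᶠ y in 𝓝 y₀, Θ (0, y) = y) {K Y : E → E}
    (hK : K =ᶠ[𝓝 y₀] fun y => fderiv ℝ Θ (0, y) (v, 0)) (hY : DifferentiableAt ℝ Y y₀) :
    HasDerivAt (fun s : ℝ => fderiv ℝ Θ (-(s • v), Θ (s • v, y₀)) (0, Y (Θ (s • v, y₀))))
      (VectorField.lieBracket ℝ K Y y₀) 0 := by
  have hΘd : DifferentiableAt ℝ Θ (0, y₀) := hΘ.differentiableAt (by simp)
  have hΘ1 : ContDiffAt ℝ 1 (fderiv ℝ Θ) (0, y₀) := hΘ.fderiv_right (by rw [one_add_one_eq_two]; exact ENat.LEInfty.out)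
  have hD : DifferentiableAt ℝ (fderiv ℝ Θ) (0, y₀) := hΘ1.differentiableAt (by simp)
  have hsymm : IsSymmSndFDerivAt ℝ Θ (0, y₀) := hΘ.isSymmSndFDerivAt
    (by rw [minSmoothness_of_isRCLikeNormedField]; exact ENat.LEInfty.out)
  have h00 : Θ (0, y₀) = y₀ := h0.self_of_nhds
  set D2 := fderiv ℝ (fderiv ℝ Θ) (0, y₀) with hD2
  have hin : ∀ y : E, HasFDerivAt (fun y : E => ((0 : V), y)) (ContinuousLinearMap.inr ℝ V E) y :=
    fun y => (ContinuousLinearMap.inr ℝ V E).hasFDerivAt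
  -- the partial derivative in the second variable at `0` is the identity
  have hid : ∀ᶠ y in 𝓝 y₀, ∀ w : E, fderiv ℝ Θ (0, y) (0, w) = w := by
    have hev : ∀ᶠ y in 𝓝 y₀, DifferentiableAt ℝ Θ (0, y) := by
      have hc : Filter.Tendsto (fun y : E => ((0 : V), y)) (𝓝 y₀) (𝓝 (0, y₀)) :=
        (Continuous.prodMk_right 0).continuousAt
      exact hc.eventually ((hΘ.of_le (m := 1) (ENat.LEInfty.out)).eventually (by simp)
        |>.mono fun x hx => hx.differentiableAt (by simp))
    filter_upwards [hev, h0.eventually_nhds] with y hy1 hy2 w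
    have h1 : HasFDerivAt (fun y : E => Θ (0, y)) _ y := hy1.hasFDerivAt.comp y (hin y)
    have h2 : HasFDerivAt (fun y : E => Θ (0, y)) (ContinuousLinearMap.id ℝ E) y :=
      (hasFDerivAt_id y).congr_of_eventuallyEq hy2
    have := DFunLike.congr_fun (h1.unique h2) w
    simpa using this
  -- The partial derivative of Θ in y is constantly the identity along {0} × E, so its derivative in
  -- y vanishes.
  have hD22 : ∀ a w : E, D2 (0, a) (0, w) = 0 := by
    intro a w
    have h1 : HasFDerivAt (fun y : E => fderiv ℝ Θ (0, y) (0, w)) _ y₀ :=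
      ((hD.hasFDerivAt.comp y₀ (hin y₀)).clm_apply (hasFDerivAt_const ((0 : V), w) y₀))
    have h2 : HasFDerivAt (fun y : E => fderiv ℝ Θ (0, y) (0, w)) (0 : E →L[ℝ] E) y₀ :=
      (hasFDerivAt_const w y₀).congr_of_eventuallyEq (hid.mono fun y hy => hy w)
    have := DFunLike.congr_fun (h1.unique h2) a
    simpa using this
  have hKd : fderiv ℝ K y₀ = ((ContinuousLinearMap.apply ℝ E (v, (0 : E))).comp D2).comp
      (ContinuousLinearMap.inr ℝ V E) := by
    rw [hK.fderiv_eq]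
    have h1 : HasFDerivAt (fun y : E => fderiv ℝ Θ (0, y) (v, 0)) _ y₀ :=
      ((hD.hasFDerivAt.comp y₀ (hin y₀)).clm_apply (hasFDerivAt_const (v, (0 : E)) y₀))
    rw [h1.fderiv]
    ext a; simp [hD2]
  have hlin : HasDerivAt (fun s : ℝ => s • v) v 0 := by
    simpa using (hasDerivAt_id (0 : ℝ)).smul_const v
  have hp1 : HasDerivAt (fun s : ℝ => (s • v, y₀)) (v, (0 : E)) 0 :=
    hlin.prodMk (hasDerivAt_const 0 y₀)
  have hy : HasDerivAt (fun s : ℝ => Θ (s • v, y₀)) (K y₀) 0 := by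
    have h1 : HasFDerivAt Θ (fderiv ℝ Θ (0, y₀)) ((0 : ℝ) • v, y₀) := by
      simpa using hΘd.hasFDerivAt
    have := h1.comp_hasDerivAt (0 : ℝ) hp1
    rw [hK.self_of_nhds]; exact this
  have hYs : HasDerivAt (fun s : ℝ => Y (Θ (s • v, y₀))) (fderiv ℝ Y y₀ (K y₀)) 0 := by
    have h1 : HasFDerivAt Y (fderiv ℝ Y y₀) (Θ ((0 : ℝ) • v, y₀)) := by
      simpa [h00] using hY.hasFDerivAt
    exact h1.comp_hasDerivAt (0 : ℝ) hy
  have hq : HasDerivAt (fun s : ℝ => (-(s • v), Θ (s • v, y₀))) (-v, K y₀) 0 := hlin.neg.prodMk hy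
  have hF : HasDerivAt (fun s : ℝ => fderiv ℝ Θ (-(s • v), Θ (s • v, y₀))) (D2 (-v, K y₀)) 0 := by
    have h1 : HasFDerivAt (fderiv ℝ Θ) D2 (-((0 : ℝ) • v), Θ ((0 : ℝ) • v, y₀)) := by
      simpa [h00] using hD.hasFDerivAt
    exact h1.comp_hasDerivAt (0 : ℝ) hq
  have hfin := hF.clm_apply ((hasDerivAt_const (0 : ℝ) (0 : V)).prodMk hYs)
  convert hfin using 1
  simp only [zero_smul, neg_zero, h00, VectorField.lieBracket]
  rw [hid.self_of_nhds, hKd]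
  -- Symmetry of the second derivative moves v to the second slot, where the term becomes DK(Y).
  have e1 : D2 (-v, K y₀) (0, Y y₀) = - D2 (0, Y y₀) (v, 0) := by
    have : ((-v, K y₀) : V × E) = -(v, 0) + (0, K y₀) := by ext <;> simp
    rw [this, map_add, add_apply, hD22, map_neg, neg_apply,
      add_zero, hsymm.eq]
  rw [e1]
  simp [sub_eq_neg_add]

/-- The Lie derivative along the infinitesimal action is the Lie bracket. -/
theorem hasDerivAt_transport (T : SymplecticToric m M) (v : TorusLie m) {X : VecField m M}
    (hX : SmoothVecOn univ X) (p : M) :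
    HasDerivAt (transport v X p) (bracket (fun q => infAction v q) X p : Model m) 0 := by
  have : IsManifold 𝓘(ℝ, Model m) 1 M := .of_le (n := ∞) (by simp)
  have h0 : ∀ᶠ y in 𝓝 (extChartAt 𝓘(ℝ, Model m) p p), chartAction p (0, y) = y := by
    filter_upwards [extChartAt_target_mem_nhds p] with y hy using chartAction_zero hy
  have h1 := (chart_lieDerivative (T.contDiffAt_chartAction p) h0 (T.chartField_infAction v p)
    ((contDiffAt_chartField Filter.univ_mem hX).differentiableAt (by simp))).congr_of_eventuallyEq
      (T.mfderiv_transport v X p)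
  obtain ⟨L, hL⟩ := isInvertible_mfderiv_extChartAt
    (mem_extChartAt_source (I := 𝓘(ℝ, Model m)) p)
  let L' : Model m ≃L[ℝ] Model m := L
  have hL' : ∀ w : Model m, L' w =
    mfderiv 𝓘(ℝ, Model m) 𝓘(ℝ, Model m) (extChartAt 𝓘(ℝ, Model m) p) p w :=
    fun w => DFunLike.congr_fun hL w
  have h2 := (L'.symm : Model m →L[ℝ] Model m).hasFDerivAt.comp_hasDerivAt (0 : ℝ) h1
  rw [← mfderiv_extChartAt_bracket] at h2
  have e1 : ∀ w : Model m, (L'.symm : Model m →L[ℝ] Model m)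
      (mfderiv 𝓘(ℝ, Model m) 𝓘(ℝ, Model m) (extChartAt 𝓘(ℝ, Model m) p) p w) = w := fun w => by
    rw [← hL']; exact L'.symm_apply_apply w
  exact (h2.congr_deriv (e1 _)).congr_of_eventuallyEq (.of_forall fun s => (e1 _).symm)

end SymplecticToric
end

/-! ### Calculus of brackets; generators against invariant objects. -/

noncomputable section

set_option linter.unusedSectionVars false

section Fields

variable {m : ℕ} {M : Type*} [TopologicalSpace M] [ChartedSpace (Model m) M]
  [IsManifold 𝓘(ℝ, Model m) ∞ M] {U : Set M}

theorem SmoothVecOn.add {X Y : VecField m M} (hX : SmoothVecOn U X) (hY : SmoothVecOn U Y) :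
    SmoothVecOn U (fun q => X q + Y q) :=
  ContMDiffOn.add_section (V := TangentSpace 𝓘(ℝ, Model m)) hX hY

theorem SmoothVecOn.const_smul {X : VecField m M} (c : ℝ) (hX : SmoothVecOn U X) :
    SmoothVecOn U (fun q => c • X q) :=
  ContMDiffOn.const_smul_section (V := TangentSpace 𝓘(ℝ, Model m)) (a := c) hX

theorem SmoothVecOn.smul {X : VecField m M} {f : M → ℝ}
    (hf : ContMDiffOn 𝓘(ℝ, Model m) 𝓘(ℝ, ℝ) ∞ f U) (hX : SmoothVecOn U X) :
    SmoothVecOn U (fun q => f q • X q) :=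
  ContMDiffOn.smul_section (V := TangentSpace 𝓘(ℝ, Model m)) hf hX

theorem SmoothVecOn.sum {ι : Type*} (s : Finset ι) {X : ι → VecField m M}
    (hX : ∀ i ∈ s, SmoothVecOn U (X i)) : SmoothVecOn U (fun q => ∑ i ∈ s, X i q) :=
  ContMDiffOn.sum_section (V := TangentSpace 𝓘(ℝ, Model m)) hX

theorem SmoothEndOn.apply {J : EndField m M} {X : VecField m M} (hJ : SmoothEndOn U J)
    (hX : SmoothVecOn U X) : SmoothVecOn U (fun q => J q (X q)) :=
  ContMDiffOn.clm_bundle_apply hJ hX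

theorem SmoothVecOn.mdifferentiableAt {X : VecField m M} (hX : SmoothVecOn univ X) (p : M) :
    MDifferentiableAt 𝓘(ℝ, Model m) 𝓘(ℝ, Model m).tangent
      (fun q => (⟨q, X q⟩ : TangentBundle 𝓘(ℝ, Model m) M)) p :=
  (contMDiffOn_univ.1 hX).mdifferentiable (by simp) p

theorem bracket_swap (X Y : VecField m M) (p : M) : bracket X Y p = -bracket Y X p :=
  VectorField.mlieBracket_swap_apply

theorem bracket_add_left {X X' : VecField m M} (hX : SmoothVecOn univ X)
    (hX' : SmoothVecOn univ X') (Y : VecField m M) (p : M) :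
    bracket (fun q => X q + X' q) Y p = bracket X Y p + bracket X' Y p := by
  have : IsManifold 𝓘(ℝ, Model m) 2 M := .of_le (n := ∞) ENat.LEInfty.out
  exact VectorField.mlieBracket_add_left (hX.mdifferentiableAt p) (hX'.mdifferentiableAt p)

theorem bracket_add_right {X X' : VecField m M} (hX : SmoothVecOn univ X)
    (hX' : SmoothVecOn univ X') (Y : VecField m M) (p : M) :
    bracket Y (fun q => X q + X' q) p = bracket Y X p + bracket Y X' p := by
  rw [bracket_swap, bracket_add_left hX hX', bracket_swap X, bracket_swap X']; abel

theorem bracket_const_smul_left {X : VecField m M} (c : ℝ) (hX : SmoothVecOn univ X)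
    (Y : VecField m M) (p : M) :
    bracket (fun q => c • X q) Y p = c • bracket X Y p := by
  have : IsManifold 𝓘(ℝ, Model m) 2 M := .of_le (n := ∞) ENat.LEInfty.out
  exact VectorField.mlieBracket_const_smul_left (hX.mdifferentiableAt p)

theorem bracket_const_smul_right {X : VecField m M} (c : ℝ) (hX : SmoothVecOn univ X)
    (Y : VecField m M) (p : M) :
    bracket Y (fun q => c • X q) p = c • bracket Y X p := by
  rw [bracket_swap, bracket_const_smul_left c hX, bracket_swap X, smul_neg, neg_neg]

theorem bracket_smul_left {X : VecField m M} {f : M → ℝ}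
    (hf : ContMDiff 𝓘(ℝ, Model m) 𝓘(ℝ, ℝ) ∞ f) (hX : SmoothVecOn univ X)
    (Y : VecField m M) (p : M) :
    bracket (fun q => f q • X q) Y p = f p • bracket X Y p - dfun f p (Y p) • X p := by
  have : IsManifold 𝓘(ℝ, Model m) 2 M := .of_le (n := ∞) ENat.LEInfty.out
  have h := VectorField.mlieBracket_smul_left (I := 𝓘(ℝ, Model m)) (W := Y)
    (hf.mdifferentiable (by simp) p) (hX.mdifferentiableAt p)
  refine h.trans ?_
  rw [neg_smul, neg_add_eq_sub]
  rfl

theorem bracket_zero_left (Y : VecField m M) (p : M) :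
    bracket (fun _ => 0) Y p = 0 :=
  congrFun (VectorField.mlieBracket_zero_left (I := 𝓘(ℝ, Model m)) (W := Y)) p

theorem bracket_sum_left {ι : Type*} (s : Finset ι) {X : ι → VecField m M}
    (hX : ∀ i, SmoothVecOn univ (X i)) (Y : VecField m M) (p : M) :
    bracket (fun q => ∑ i ∈ s, X i q) Y p = ∑ i ∈ s, bracket (X i) Y p := by
  classical
  induction s using Finset.induction_on with
  | empty => simpa using bracket_zero_left Y p
  | insert a s ha ih =>
    simp only [Finset.sum_insert ha]
    rw [bracket_add_left (hX a) (SmoothVecOn.sum s fun i _ => hX i), ih]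

theorem bracket_congr {X X' Y Y' : VecField m M} {p : M} (hU : U ∈ 𝓝 p)
    (hX : ∀ q ∈ U, X q = X' q) (hY : ∀ q ∈ U, Y q = Y' q) : bracket X Y p = bracket X' Y' p :=
  Filter.EventuallyEq.mlieBracket_vectorField_eq (Filter.eventually_of_mem hU hX)
    (Filter.eventually_of_mem hU hY)

end Fields

namespace SymplecticToric

variable {m : ℕ} {M : Type*} [TopologicalSpace M] [ChartedSpace (Model m) M]
  [IsManifold 𝓘(ℝ, Model m) ∞ M] [MulAction (Torus m) M]

theorem torusExp_neg_smul_smul (u : TorusLie m) (p : M) : torusExp (-u) • torusExp u • p = p := by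
  rw [← mul_smul, ← torusExp_add]; simp [torusExp_zero]

/-- Every tangent space is definitionally the model space, so values at propositionally equal points
can be compared directly. -/
theorem endField_congr (J : EndField m M) {p q : M} (h : p = q) (w : Model m) :
    (J p (show TanSp m p from w) : Model m) = J q (show TanSp m q from w) := by
  subst h; rfl

theorem vecField_congr (X : VecField m M) {p q : M} (h : p = q) :
    (X p : Model m) = X q := by
  subst h; rfl

/-- Invariant endomorphism fields are preserved by the infinitesimal action. -/
theorem bracket_infAction_endField (T : SymplecticToric m M) {J : EndField m M}
    (hJ : SmoothEndOn univ J) (hinv : T.InvariantOn univ J) (v : TorusLie m)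
    {X : VecField m M} (hX : SmoothVecOn univ X) (p : M) :
    bracket (fun q => infAction v q) (fun q => J q (X q)) p =
      J p (bracket (fun q => infAction v q) X p) := by
  have h1 := T.hasDerivAt_transport v (hJ.apply hX) p
  let L : Model m →L[ℝ] Model m := J p
  have h2 := L.hasFDerivAt.comp_hasDerivAt (0 : ℝ) (T.hasDerivAt_transport v hX p)
  -- By invariance J commutes with the transport, so both sides of the claim are derivatives of the
  -- same curve.
  have h3 : transport v (fun q => J q (X q)) p = L ∘ transport v X p := by
    funext s
    refine (hinv (torusExp (-(s • v))) (torusExp (s • v) • p) (mem_univ _)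
      (X (torusExp (s • v) • p))).trans ?_
    exact endField_congr J (torusExp_neg_smul_smul _ _) _
  rw [h3] at h1
  exact h1.unique h2

/-- Equivariance of w^♯ makes its transport along the orbits constant. -/
theorem bracket_infAction_infAction (T : SymplecticToric m M) (v w : TorusLie m) (p : M) :
    bracket (fun q : M => infAction v q) (fun q => infAction w q) p = 0 := by
  have h1 := T.hasDerivAt_transport v (T.infAction_smooth w) p
  have h2 : transport v (fun q : M => infAction w q) p = fun _ => infAction w p := by
    funext s
    unfold transport
    rw [← T.infAction_smul]
    exact vecField_congr (fun q => infAction w q) (torusExp_neg_smul_smul _ _)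
  rw [h2] at h1
  exact h1.unique (hasDerivAt_const _ _)

theorem dfun_bracket_infAction (T : SymplecticToric m M) {f : M → ℝ}
    (hf : ContMDiff 𝓘(ℝ, Model m) 𝓘(ℝ, ℝ) ∞ f) (hinv : ∀ (g : Torus m) p, f (g • p) = f p)
    (v : TorusLie m) {X : VecField m M} (hX : SmoothVecOn univ X) (p : M) :
    dfun f p (bracket (fun q => infAction v q) X p) =
      dfun (fun q => dfun f q (X q)) p (infAction v p) := by
  rw [dfun_bracket hf (T.infAction_smooth v) hX]
  have : (fun q => dfun f q (infAction v q)) = fun _ => (0 : ℝ) :=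
    funext fun q => T.dfun_infAction hf hinv v q
  rw [this]
  have h0 : dfun (m := m) (fun _ : M => (0 : ℝ)) p = 0 := mfderiv_const
  rw [h0]; simp

end SymplecticToric
end

/-! ### The shear ∑ K_i ⊗ dμ^i and its bracket identities. -/

noncomputable section

set_option linter.unusedSectionVars false

section WeightedSum

variable {ι E E' : Type*} [Fintype ι] [AddCommGroup E] [Module ℝ E] [AddCommGroup E'] [Module ℝ E']

/-- The sum of the vectors `k i` with the weights `a i`. -/
def weightedSum (a : ι → ℝ) (k : ι → E) : E := ∑ i, a i • k i

theorem weightedSum_add_left (a b : ι → ℝ) (k : ι → E) :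
    weightedSum (fun i => a i + b i) k = weightedSum a k + weightedSum b k := by
  simp [weightedSum, add_smul, Finset.sum_add_distrib]

theorem weightedSum_sub_left (a b : ι → ℝ) (k : ι → E) :
    weightedSum (fun i => a i - b i) k = weightedSum a k - weightedSum b k := by
  simp [weightedSum, sub_smul, Finset.sum_sub_distrib]

theorem weightedSum_zero_right (a : ι → ℝ) : weightedSum a (fun _ => (0 : E)) = 0 := by
  simp [weightedSum]

theorem map_weightedSum {F : Type*} [FunLike F E E'] [LinearMapClass F ℝ E E'] (L : F)
    (a : ι → ℝ) (k : ι → E) : L (weightedSum a k) = weightedSum a (fun i => L (k i)) := by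
  simp [weightedSum]

theorem weightedSum_comm (a : ι → ℝ) (B : ι → ι → ℝ) (k : ι → E) :
    weightedSum a (fun i => weightedSum (B i) k) =
      weightedSum (fun j => weightedSum a (fun i => B i j)) k := by
  simp only [weightedSum, Finset.smul_sum, Finset.sum_smul, smul_smul, smul_eq_mul]
  exact Finset.sum_comm

end WeightedSum

namespace SymplecticToric

variable {m : ℕ} {M : Type*} [TopologicalSpace M] [ChartedSpace (Model m) M]
  [IsManifold 𝓘(ℝ, Model m) ∞ M] [MulAction (Torus m) M]

/-- The nilpotent field of endomorphisms `∑ K_{ξ i} ⊗ dμ^{η i}`. -/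
def shear (T : SymplecticToric m M) (ξ η : Fin m → TorusLie m) : EndField m M := fun p =>
  ∑ i, (dfun (fun q => T.moment q (η i)) p).smulRight (infAction (ξ i) p)

variable (T : SymplecticToric m M) (ξ η : Fin m → TorusLie m)

theorem shear_apply (p : M) (w : TanSp m p) :
    T.shear ξ η p w = weightedSum (fun i => dfun (fun q => T.moment q (η i)) p w)
      (fun i => infAction (ξ i) p) := by
  simp [shear, weightedSum]

theorem dfun_moment_infAction (u v : TorusLie m) (p : M) :
    dfun (fun q => T.moment q u) p (infAction v p) = 0 :=
  T.dfun_infAction (T.contMDiff_moment u) (fun g q => by rw [T.moment_invariant]) v p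

theorem dfun_moment_bracket (u v : TorusLie m) {X : VecField m M} (hX : SmoothVecOn univ X)
    (p : M) :
    dfun (fun q => T.moment q u) p (bracket (fun q => infAction v q) X p) =
      dfun (fun q => dfun (fun q => T.moment q u) q (X q)) p (infAction v p) :=
  T.dfun_bracket_infAction (T.contMDiff_moment u) (fun g q => by rw [T.moment_invariant]) v hX p

theorem smooth_shear_apply {U : Set M} {X : VecField m M} (hX : SmoothVecOn U X) :
    SmoothVecOn U (fun q => T.shear ξ η q (X q)) := by
  have h : (fun q => T.shear ξ η q (X q)) = fun q =>
      ∑ i, dfun (fun r => T.moment r (η i)) q (X q) • infAction (ξ i) q := by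
    funext q; exact T.shear_apply ξ η q (X q)
  rw [h]
  exact SmoothVecOn.sum _ fun i _ => SmoothVecOn.smul (contMDiffOn_dfun (T.contMDiff_moment _) hX)
    ((T.infAction_smooth (ξ i)).mono (subset_univ U))

theorem bracket_shear_left {X : VecField m M} (hX : SmoothVecOn univ X) (Y : VecField m M) (p : M) :
    bracket (fun q => T.shear ξ η q (X q)) Y p =
      weightedSum (fun i => dfun (fun r => T.moment r (η i)) p (X p))
        (fun i => bracket (fun q => infAction (ξ i) q) Y p) -
      weightedSum (fun i => dfun (fun q => dfun (fun r => T.moment r (η i)) q (X q)) p (Y p))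
        (fun i => infAction (ξ i) p) := by
  have h : (fun q => T.shear ξ η q (X q)) = fun q =>
      ∑ i, dfun (fun r => T.moment r (η i)) q (X q) • infAction (ξ i) q := by
    funext q; exact T.shear_apply ξ η q (X q)
  have hs : ∀ i, ContMDiff 𝓘(ℝ, Model m) 𝓘(ℝ, ℝ) ∞
    (fun q => dfun (fun r => T.moment r (η i)) q (X q)) :=
    fun i => contMDiff_dfun (T.contMDiff_moment _) hX
  rw [h, bracket_sum_left _ fun i => SmoothVecOn.smul (hs i).contMDiffOn (T.infAction_smooth (ξ i))]
  simp only [weightedSum, ← Finset.sum_sub_distrib]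
  exact Finset.sum_congr rfl fun i _ => bracket_smul_left (hs i) (T.infAction_smooth (ξ i)) Y p

/-- The generators preserve the shear: they commute with one another and, since dμ kills them, the
derivative of dμ(X) along v^♯ is dμ([v^♯, X]). -/
theorem bracket_infAction_shear (v : TorusLie m) {X : VecField m M} (hX : SmoothVecOn univ X)
    (p : M) :
    bracket (fun q => infAction v q) (fun q => T.shear ξ η q (X q)) p =
      T.shear ξ η p (bracket (fun q => infAction v q) X p) := by
  rw [bracket_swap, T.bracket_shear_left ξ η hX]
  simp only [T.bracket_infAction_infAction, weightedSum_zero_right, zero_sub, neg_neg, shear_apply]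
  congr 1
  funext i
  exact (T.dfun_moment_bracket _ v hX p).symm

/-- Controls the terms of order t²: they lie in the image of the shear, so they can be matched with
the shear of the order-t part of V in `bracket_shear_integrable`. -/
theorem bracket_shear_shear {X Y : VecField m M} (hX : SmoothVecOn univ X)
    (hY : SmoothVecOn univ Y) (p : M) :
    bracket (fun q => T.shear ξ η q (X q)) (fun q => T.shear ξ η q (Y q)) p =
      T.shear ξ η p
        (weightedSum (fun i => dfun (fun r => T.moment r (η i)) p (X p))
          (fun i => bracket (fun q => infAction (ξ i) q) Y p) -
        weightedSum (fun i => dfun (fun r => T.moment r (η i)) p (Y p))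
          (fun i => bracket (fun q => infAction (ξ i) q) X p)) := by
  rw [T.bracket_shear_left ξ η hX, map_sub, map_weightedSum, map_weightedSum]
  simp only [T.bracket_infAction_shear ξ η _ hY]
  congr 1
  conv_rhs => simp only [shear_apply]
  rw [weightedSum_comm]
  congr 1
  funext j
  rw [shear_apply, map_weightedSum]
  simp only [T.dfun_moment_bracket _ _ hX]

theorem bracket_add_shear {X Y Z W : VecField m M} (hX : SmoothVecOn univ X)
    (hY : SmoothVecOn univ Y) (hZ : SmoothVecOn univ Z) (hW : SmoothVecOn univ W) (s r : ℝ) (p : M) :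
    bracket (fun q => X q + s • T.shear ξ η q (Z q)) (fun q => Y q + r • T.shear ξ η q (W q)) p =
      bracket X Y p +
      s • (weightedSum (fun i => dfun (fun r => T.moment r (η i)) p (Z p))
            (fun i => bracket (fun q => infAction (ξ i) q) Y p) -
          weightedSum (fun i => dfun (fun q => dfun (fun r => T.moment r (η i)) q (Z q)) p (Y p))
            (fun i => infAction (ξ i) p)) -
      r • (weightedSum (fun i => dfun (fun r => T.moment r (η i)) p (W p))
            (fun i => bracket (fun q => infAction (ξ i) q) X p) -
          weightedSum (fun i => dfun (fun q => dfun (fun r => T.moment r (η i)) q (W q)) p (X p))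
            (fun i => infAction (ξ i) p)) +
      (s * r) • T.shear ξ η p
        (weightedSum (fun i => dfun (fun r => T.moment r (η i)) p (Z p))
          (fun i => bracket (fun q => infAction (ξ i) q) W p) -
        weightedSum (fun i => dfun (fun r => T.moment r (η i)) p (W p))
          (fun i => bracket (fun q => infAction (ξ i) q) Z p)) := by
  have hAZ := T.smooth_shear_apply ξ η hZ
  have hAW := T.smooth_shear_apply ξ η hW
  rw [bracket_add_left hX (hAZ.const_smul s), bracket_add_right hY (hAW.const_smul r),
    bracket_const_smul_right r hAW, bracket_const_smul_left s hAZ,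
    bracket_add_right hY (hAW.const_smul r), bracket_const_smul_right r hAW,
    T.bracket_shear_shear ξ η hZ hW, T.bracket_shear_left ξ η hZ,
    bracket_swap X (fun q => T.shear ξ η q (W q)), T.bracket_shear_left ξ η hW]
  module

/-- The Nijenhuis-type identities behind the integrability of the sheared complex structure. -/
theorem bracket_shear_integrable {J : EndField m M} (hJ : AlmostComplexOn univ J)
    (hint : IntegrableOnSet univ J) (hinv : T.InvariantOn univ J) (t : ℝ)
    {X Y : VecField m M} (hX : SmoothVecOn univ X) (hY : SmoothVecOn univ Y) (p : M) :
    ∃ V : TanSp m p,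
      bracket (fun q => J q (X q) + t • T.shear ξ η q (X q))
          (fun q => Y q + (-t) • T.shear ξ η q (J q (Y q))) p +
        bracket (fun q => X q + (-t) • T.shear ξ η q (J q (X q)))
          (fun q => J q (Y q) + t • T.shear ξ η q (Y q)) p =
        V - t • T.shear ξ η p (J p V) ∧
      bracket (fun q => J q (X q) + t • T.shear ξ η q (X q))
          (fun q => J q (Y q) + t • T.shear ξ η q (Y q)) p -
        bracket (fun q => X q + (-t) • T.shear ξ η q (J q (X q)))
          (fun q => Y q + (-t) • T.shear ξ η q (J q (Y q))) p =
        J p V + t • T.shear ξ η p V := by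
  have hX' := hJ.1.apply hX
  have hY' := hJ.1.apply hY
  have hJJ : ∀ w : TanSp m p, J p (J p w) = -w := hJ.2 p (mem_univ p)
  have hKY : ∀ i, bracket (fun q => infAction (ξ i) q) (fun q => J q (Y q)) p =
      J p (bracket (fun q => infAction (ξ i) q) Y p) :=
    fun i => T.bracket_infAction_endField hJ.1 hinv (ξ i) hY p
  have hKX : ∀ i, bracket (fun q => infAction (ξ i) q) (fun q => J q (X q)) p =
      J p (bracket (fun q => infAction (ξ i) q) X p) :=
    fun i => T.bracket_infAction_endField hJ.1 hinv (ξ i) hX p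
  have hN : bracket (fun q => J q (X q)) (fun q => J q (Y q)) p =
      J p (bracket (fun q => J q (X q)) Y p + bracket X (fun q => J q (Y q)) p) +
        bracket X Y p := by
    have := hint X Y hX hY p (mem_univ p)
    rw [map_add, ← sub_eq_zero, ← this]
    abel
  rw [T.bracket_add_shear ξ η hX' hY hX hY', T.bracket_add_shear ξ η hX hY' hX' hY,
    T.bracket_add_shear ξ η hX' hY' hX hY, T.bracket_add_shear ξ η hX hY hX' hY']
  simp only [hKX, hKY, ← map_weightedSum]
  -- N_{J₀} = 0 replaces J([JX, Y] + [X, JY]) by [JX, JY] - [X, Y]; dμ of these brackets then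
  -- consists of second derivatives, the same as in the order-t terms along the K_i.
  have h2 : ∀ i, dfun (fun r => T.moment r (η i)) p
      (J p (bracket (fun q => J q (X q)) Y p + bracket X (fun q => J q (Y q)) p)) =
      (dfun (fun q => dfun (fun r => T.moment r (η i)) q (J q (Y q))) p (J p (X p)) -
       dfun (fun q => dfun (fun r => T.moment r (η i)) q (J q (X q))) p (J p (Y p))) -
      (dfun (fun q => dfun (fun r => T.moment r (η i)) q (Y q)) p (X p) -
       dfun (fun q => dfun (fun r => T.moment r (η i)) q (X q)) p (Y p)) := by
    intro i
    have e := congrArg (dfun (fun r => T.moment r (η i)) p) hN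
    rw [map_add, dfun_bracket (T.contMDiff_moment _) hX' hY',
      dfun_bracket (T.contMDiff_moment _) hX hY] at e
    linear_combination -e
  have h2' : T.shear ξ η p
      (J p (bracket (fun q => J q (X q)) Y p + bracket X (fun q => J q (Y q)) p)) =
      (weightedSum (fun i => dfun (fun q => dfun (fun r => T.moment r (η i)) q (J q (Y q))) p (J p (X p))) (fun i => infAction (ξ i) p) -
        weightedSum (fun i => dfun (fun q => dfun (fun r => T.moment r (η i)) q (J q (X q))) p (J p (Y p))) (fun i => infAction (ξ i) p)) -
       (weightedSum (fun i => dfun (fun q => dfun (fun r => T.moment r (η i)) q (Y q)) p (X p)) (fun i => infAction (ξ i) p) -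
        weightedSum (fun i => dfun (fun q => dfun (fun r => T.moment r (η i)) q (X q)) p (Y p)) (fun i => infAction (ξ i) p)) := by
    rw [shear_apply]; simp only [h2, weightedSum_sub_left]
  have h3 : ∀ i, dfun (fun r => T.moment r (η i)) p
      (bracket (fun q => J q (X q)) Y p + bracket X (fun q => J q (Y q)) p) =
      (dfun (fun q => dfun (fun r => T.moment r (η i)) q (Y q)) p (J p (X p)) -
       dfun (fun q => dfun (fun r => T.moment r (η i)) q (J q (X q))) p (Y p)) +
      (dfun (fun q => dfun (fun r => T.moment r (η i)) q (J q (Y q))) p (X p) -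
       dfun (fun q => dfun (fun r => T.moment r (η i)) q (X q)) p (J p (Y p))) := by
    intro i
    rw [map_add, dfun_bracket (T.contMDiff_moment _) hX' hY,
      dfun_bracket (T.contMDiff_moment _) hX hY']
  have h3' : T.shear ξ η p
      (bracket (fun q => J q (X q)) Y p + bracket X (fun q => J q (Y q)) p) =
      (weightedSum (fun i => dfun (fun q => dfun (fun r => T.moment r (η i)) q (Y q)) p (J p (X p))) (fun i => infAction (ξ i) p) -
        weightedSum (fun i => dfun (fun q => dfun (fun r => T.moment r (η i)) q (J q (X q))) p (Y p)) (fun i => infAction (ξ i) p)) +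
       (weightedSum (fun i => dfun (fun q => dfun (fun r => T.moment r (η i)) q (J q (Y q))) p (X p)) (fun i => infAction (ξ i) p) -
        weightedSum (fun i => dfun (fun q => dfun (fun r => T.moment r (η i)) q (X q)) p (J p (Y p))) (fun i => infAction (ξ i) p)) := by
    rw [shear_apply]; simp only [h3, weightedSum_sub_left, weightedSum_add_left]
  -- V is the value at t = 0 plus t times the terms of the expansion containing [K_i, X] or [K_i,
  -- Y]. The terms along the K_i are produced by the shear of V or JV.
  refine ⟨bracket (fun q => J q (X q)) Y p + bracket X (fun q => J q (Y q)) p +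
    t • (weightedSum (fun i => dfun (fun r => T.moment r (η i)) p (X p))
          (fun i => bracket (fun q => infAction (ξ i) q) Y p) -
      weightedSum (fun i => dfun (fun r => T.moment r (η i)) p (J p (X p)))
          (fun i => J p (bracket (fun q => infAction (ξ i) q) Y p)) -
      weightedSum (fun i => dfun (fun r => T.moment r (η i)) p (Y p))
          (fun i => bracket (fun q => infAction (ξ i) q) X p) +
      weightedSum (fun i => dfun (fun r => T.moment r (η i)) p (J p (Y p)))
          (fun i => J p (bracket (fun q => infAction (ξ i) q) X p))), ?_, ?_⟩
  · rw [map_add (J p), map_add (T.shear ξ η p), h2']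
    simp only [← map_weightedSum, map_add, map_sub, map_smul, hJJ, map_neg]
    module
  · rw [map_add (J p), map_add (T.shear ξ η p), h3', hN]
    simp only [← map_weightedSum, map_add, map_sub, map_smul, hJJ]
    module

end SymplecticToric
end

/-! ### Linear algebra of conjugation by 1 - tAJ. -/

noncomputable section

set_option linter.unusedSectionVars false

section ConjugateByShear

variable {V : Type*} [TopologicalSpace V] [AddCommGroup V] [Module ℝ V] [IsTopologicalAddGroup V]
  [ContinuousSMul ℝ V]

/-- The operator `1 - t A J`. -/
def shearFactor (A J : V →L[ℝ] V) (t : ℝ) : V →L[ℝ] V :=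
  ContinuousLinearMap.id ℝ V - t • A.comp J

/-- The conjugate of `J` by `1 - t A J`. -/
def shearConj (A J : V →L[ℝ] V) (t : ℝ) : V →L[ℝ] V :=
  (shearFactor A J t).comp (J.comp (shearFactor A J t).inverse)

theorem shearFactor_apply (A J : V →L[ℝ] V) (t : ℝ) (X : V) :
    shearFactor A J t X = X - t • A (J X) := by
  simp [shearFactor]

theorem shearConj_zero (A J : V →L[ℝ] V) : shearConj A J 0 = J := by
  simp [shearConj, shearFactor]

/-- Pointwise data of a compatible linear complex structure `J` and a nilpotent operator `A`
that is selfadjoint for the symplectic form `w`. -/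
structure ShearData (w : V →L[ℝ] V →L[ℝ] ℝ) (J A : V →L[ℝ] V) : Prop where
  alt : ∀ X, w X X = 0
  sq : ∀ X, J (J X) = -X
  tamed : ∀ X, X ≠ 0 → 0 < w X (J X)
  compat : ∀ X Y, w (J X) (J Y) = w X Y
  nilpotent : ∀ X, A (A X) = 0
  adjoint : ∀ X Y, w (A X) Y = w X (A Y)

namespace ShearData

variable {w : V →L[ℝ] V →L[ℝ] ℝ} {J A : V →L[ℝ] V} (h : ShearData w J A)

include h

theorem skew (X Y : V) : w X Y = -w Y X := by
  have := h.alt (X + Y)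
  simp only [map_add, add_apply, h.alt] at this
  linarith

theorem apply_shear_self (X : V) : w X (A X) = 0 := by
  have h1 := h.adjoint X X
  have h2 := h.skew (A X) X
  linarith

theorem shear_apply_self (X : V) : w (A X) X = 0 := by rw [h.adjoint, h.apply_shear_self]

theorem apply_shear_shear (X Y : V) : w (A X) (A Y) = 0 := by
  rw [h.adjoint, h.nilpotent, map_zero]

theorem apply_complex (X Y : V) : w (J X) Y = -w X (J Y) := by
  have h1 := h.compat X (J Y)
  rw [h.sq, map_neg] at h1
  linarith

theorem shearFactor_complex (t : ℝ) (X : V) : shearFactor A J t (J X) = J X + t • A X := by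
  rw [shearFactor_apply, h.sq, map_neg, smul_neg, sub_neg_eq_add]

/-- The linear terms vanish because ω(Z, AZ) = 0 for every Z, the quadratic one because the image of
A is isotropic. Positivity then yields both injectivity and tameness, with no bound on t. -/
theorem shearFactor_pairing (t : ℝ) (X : V) :
    w (shearFactor A J t X) (shearFactor A J t (J X)) = w X (J X) := by
  rw [h.shearFactor_complex, shearFactor_apply]
  simp only [map_sub, map_add, map_smul, sub_apply, smul_apply,
    h.apply_shear_self, h.shear_apply_self, h.apply_shear_shear]
  simp

theorem shearFactor_injective (t : ℝ) : Function.Injective (shearFactor A J t) := by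
  rw [injective_iff_map_eq_zero]
  intro X hX
  by_contra hne
  have h1 := h.shearFactor_pairing t X
  rw [hX, map_zero, zero_apply] at h1
  exact (h.tamed X hne).ne h1

variable [T2Space V] [FiniteDimensional ℝ V]

theorem shearFactor_isInvertible (t : ℝ) : (shearFactor A J t).IsInvertible := by
  refine ⟨(LinearEquiv.ofInjectiveEndo (shearFactor A J t : V →ₗ[ℝ] V)
    (h.shearFactor_injective t)).toContinuousLinearEquiv, ?_⟩
  ext X; rfl

theorem shearFactor_surjective (t : ℝ) : Function.Surjective (shearFactor A J t) := by
  obtain ⟨e, he⟩ := h.shearFactor_isInvertible t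
  rw [← he]; exact e.surjective

theorem shearConj_shearFactor (t : ℝ) (X : V) :
    shearConj A J t (shearFactor A J t X) = shearFactor A J t (J X) := by
  simp only [shearConj, ContinuousLinearMap.comp_apply]
  rw [(h.shearFactor_isInvertible t).inverse_apply_eq.2 rfl]

theorem shearConj_sq (t : ℝ) (X : V) : shearConj A J t (shearConj A J t X) = -X := by
  obtain ⟨Y, rfl⟩ := h.shearFactor_surjective t X
  rw [h.shearConj_shearFactor, h.shearConj_shearFactor, h.sq, map_neg]

theorem shearConj_tamed (t : ℝ) (X : V) (hX : X ≠ 0) : 0 < w X (shearConj A J t X) := by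
  obtain ⟨Y, rfl⟩ := h.shearFactor_surjective t X
  rw [h.shearConj_shearFactor, h.shearFactor_pairing]
  exact h.tamed Y fun hY => hX (by rw [hY, map_zero])

/-- Substituting F_t X and F_{-t} Y clears the inverses. The sign change of t matches the linear
terms, and the quadratic terms vanish by isotropy. -/
theorem shearConj_adjoint (t : ℝ) (X Y : V) :
    w (shearConj A J t X) Y = w X (-shearConj A J (-t) Y) := by
  obtain ⟨X, rfl⟩ := h.shearFactor_surjective t X
  obtain ⟨Y, rfl⟩ := h.shearFactor_surjective (-t) Y
  rw [h.shearConj_shearFactor, h.shearConj_shearFactor, h.shearFactor_complex,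
    h.shearFactor_complex, shearFactor_apply, shearFactor_apply]
  simp only [map_sub, map_add, map_smul, sub_apply, smul_apply, add_apply, map_neg,
    h.apply_shear_shear, h.apply_complex, h.adjoint, smul_eq_mul]
  ring

/-- If the conjugate is compatible with `w`, then the shear vanishes. -/
theorem shear_eq_zero {t : ℝ} (ht : t ≠ 0)
    (hcompat : ∀ X Y, w (shearConj A J t X) (shearConj A J t Y) = w X Y) (X : V) : A X = 0 := by
  have hnd : ∀ Z, (∀ X, w X Z = 0) → Z = 0 := by
    intro Z hZ
    by_contra hne
    have h1 := h.tamed Z hne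
    rw [h.skew, hZ] at h1
    simp at h1
  -- Compatibility says that the adjoint of J_t is J_t⁻¹ = -J_t; since it is also -J_{-t}, the two
  -- conjugates agree.
  have heq : ∀ Y, shearConj A J (-t) Y = shearConj A J t Y := by
    intro Y
    refine sub_eq_zero.1 (hnd _ fun X => ?_)
    have h1 := hcompat X (shearConj A J t Y)
    rw [h.shearConj_sq, map_neg, h.shearConj_adjoint, map_neg, neg_neg] at h1
    rw [map_sub, h1, sub_self]
  -- Adding the defining relations of J_t on F_t Y and on F_{-t} Y cancels every term containing A.
  have hJ : ∀ Y, shearConj A J t Y = J Y := by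
    intro Y
    have h1 := h.shearConj_shearFactor t Y
    have h2 := h.shearConj_shearFactor (-t) Y
    rw [heq, h.shearFactor_complex, shearFactor_apply, map_sub, map_smul] at h2
    rw [h.shearFactor_complex, shearFactor_apply, map_sub, map_smul] at h1
    have h3 : (2 : ℝ) • shearConj A J t Y = (2 : ℝ) • J Y := by
      calc (2 : ℝ) • shearConj A J t Y
          = (shearConj A J t Y - t • shearConj A J t (A (J Y))) +
            (shearConj A J t Y - -t • shearConj A J t (A (J Y))) := by module
        _ = (2 : ℝ) • J Y := by rw [h1, h2]; module
    exact smul_right_injective V two_ne_zero h3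
  -- With J_t = J, F_t commutes with J, hence so does A. Then ω(AX, JAX) = ω(AX, AJX) = 0
  -- contradicts tameness unless AX = 0.
  have hcomm : J (A X) = A (J X) := by
    have h1 := h.shearConj_shearFactor t (J X)
    rw [hJ, h.shearFactor_complex, h.shearFactor_complex, h.sq, map_add, h.sq, map_smul] at h1
    exact smul_right_injective V ht (add_left_cancel h1)
  by_contra hne
  have h1 := h.tamed (A X) hne
  rw [hcomm, h.apply_shear_shear] at h1
  exact lt_irrefl _ h1

variable {W : Submodule ℝ V}

/-- F_t preserves W, by inclusion and equality of dimensions. So J_t W = J_t F_t W = (J + tA)W = JW.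
-/
theorem map_shearConj (hW : ∀ X, A X ∈ W) (hAW : ∀ X ∈ W, A X = 0) (t : ℝ) :
    W.map (shearConj A J t).toLinearMap = W.map J.toLinearMap := by
  have h1 : W.map (shearFactor A J t).toLinearMap = W := by
    refine Submodule.eq_of_le_of_finrank_eq ?_ ?_
    · rintro _ ⟨X, hX, rfl⟩
      simp only [ContinuousLinearMap.coe_coe, shearFactor_apply]
      exact W.sub_mem hX (W.smul_mem _ (hW _))
    · exact (LinearEquiv.finrank_eq (Submodule.equivMapOfInjective _
        (h.shearFactor_injective t) W)).symm
  conv_lhs => rw [← h1]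
  rw [← Submodule.map_comp]
  ext Y
  constructor <;> rintro ⟨X, hX, rfl⟩ <;> refine ⟨X, hX, ?_⟩ <;>
  simp [h.shearConj_shearFactor, h.shearFactor_complex, hAW X hX]

end ShearData

end ConjugateByShear
end

/-! ### Smoothness of endomorphism fields and locality of integrability. -/

noncomputable section

set_option linter.unusedSectionVars false

section Sections

variable {m : ℕ} {M : Type*} [TopologicalSpace M] [ChartedSpace (Model m) M]
  [IsManifold 𝓘(ℝ, Model m) ∞ M]

/-- An endomorphism field read in the trivialization of the tangent bundle at `p`. -/
def endCoord (p q : M) (A : TanSp m q →L[ℝ] TanSp m q) : Model m →L[ℝ] Model m :=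
  ContinuousLinearMap.inCoordinates (Model m) (TangentSpace 𝓘(ℝ, Model m) : M → Type _) (Model m)
    (TangentSpace 𝓘(ℝ, Model m) : M → Type _) p q p q A

/-- The fibre coordinates of the trivialization of the tangent bundle at `p`. -/
def fiberEquiv (p : M) {q : M}
    (hq : q ∈ (trivializationAt (Model m) (TangentSpace 𝓘(ℝ, Model m) : M → Type _) p).baseSet) :
    TanSp m q ≃L[ℝ] Model m :=
  (trivializationAt (Model m) (TangentSpace 𝓘(ℝ, Model m) : M → Type _) p).continuousLinearEquivAt
    ℝ q hq

theorem endCoord_apply {p q : M}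
    (hq : q ∈ (trivializationAt (Model m) (TangentSpace 𝓘(ℝ, Model m) : M → Type _) p).baseSet)
    (A : TanSp m q →L[ℝ] TanSp m q) (x : Model m) :
    endCoord p q A x = fiberEquiv p hq (A ((fiberEquiv p hq).symm x)) := by
  rw [endCoord, ContinuousLinearMap.inCoordinates_eq hq hq]
  rfl

theorem contMDiffWithinAt_endField_iff {N : Type*} {E' H' : Type*} [NormedAddCommGroup E']
    [NormedSpace ℝ E'] [TopologicalSpace H'] {I' : ModelWithCorners ℝ E' H'} [TopologicalSpace N]
    [ChartedSpace H' N] {b : N → M} {A : (x : N) → TanSp m (b x) →L[ℝ] TanSp m (b x)} {s : Set N}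
    {x₀ : N} :
    ContMDiffWithinAt I' (𝓘(ℝ, Model m).prod 𝓘(ℝ, Model m →L[ℝ] Model m)) ∞
      (fun x => TotalSpace.mk' (Model m →L[ℝ] Model m)
        (E := fun p : M => TanSp m p →L[ℝ] TanSp m p) (b x) (A x)) s x₀ ↔
    ContMDiffWithinAt I' 𝓘(ℝ, Model m) ∞ b s x₀ ∧
      ContMDiffWithinAt I' 𝓘(ℝ, Model m →L[ℝ] Model m) ∞
        (fun x => endCoord (b x₀) (b x) (A x)) s x₀ :=
  contMDiffWithinAt_hom_bundle _

/-- An endomorphism field is smooth if it maps local smooth fields to smooth fields. -/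
theorem smoothEndOn_of_apply {A : EndField m M}
    (hA : ∀ (U : Set M) (X : VecField m M), IsOpen U → SmoothVecOn U X →
      SmoothVecOn U (fun q => A q (X q))) : SmoothEndOn univ A := by
  intro p _
  rw [contMDiffWithinAt_univ, ← contMDiffWithinAt_univ, contMDiffWithinAt_endField_iff]
  refine ⟨contMDiffWithinAt_id, ?_⟩
  rw [contMDiffWithinAt_univ]
  set e := trivializationAt (Model m) (TangentSpace 𝓘(ℝ, Model m) : M → Type _) p with he
  have hp : p ∈ e.baseSet := mem_baseSet_trivializationAt _ _ p
  have key : ∀ x : Model m, ContMDiffAt 𝓘(ℝ, Model m) 𝓘(ℝ, Model m) ∞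
      (fun q => endCoord p q (A q) x) p := by
    intro x
    -- The local field with constant fibre coordinate x: applying A to it gives one column of the
    -- coordinate matrix.
    have hσ : SmoothVecOn e.baseSet (fun q => e.symm q x) := by
      refine (e.contMDiffOn_section_baseSet_iff (IB := 𝓘(ℝ, Model m)) (n := ∞)).2
        ((contMDiffOn_const (c := x)).congr fun q hq => ?_)
      rw [e.mk_symm hq, e.apply_symm_apply (e.mem_target.2 hq)]
    have h1 := ((hA _ _ e.open_baseSet hσ) p hp).contMDiffAt (e.open_baseSet.mem_nhds hp)
    rw [contMDiffAt_totalSpace] at h1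
    refine h1.2.congr_of_eventuallyEq ?_
    filter_upwards [e.open_baseSet.mem_nhds hp] with q hq
    rw [endCoord_apply hq, fiberEquiv]
    simp only [Trivialization.coe_continuousLinearEquivAt_eq,
      Trivialization.symm_continuousLinearEquivAt_eq, Trivialization.continuousLinearMapAt_apply]
    rw [Trivialization.symmL_apply _ hq]
    exact congrFun (e.coe_linearMapAt_of_mem (R := ℝ) hq) (A q (e.symm q x))
  let b := Module.finBasis ℝ (Model m)
  have hsum : (fun q => endCoord p q (A q)) = fun q => ∑ i,
      ContinuousLinearMap.smulRightL ℝ (Model m) (Model m) (b.coord i).toContinuousLinearMap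
        (endCoord p q (A q) (b i)) := by
    funext q
    ext1 x
    conv_lhs => rw [← b.sum_repr x, map_sum]
    simp only [map_smul, sum_apply]
    rfl
  show ContMDiffAt _ _ _ (fun q => endCoord p q (A q)) p
  rw [hsum]
  exact contMDiffAt_finsetSum fun i _ =>
    (ContinuousLinearMap.contDiff _).contMDiff.contMDiffAt.comp p (key (b i))

/-- Conjugation of a smooth complex structure by `1 - t A J` is smooth, also in `t`. -/
theorem contMDiff_shearConj {A J : EndField m M} (hA : SmoothEndOn univ A) (hJ : SmoothEndOn univ J)
    (hinv : ∀ (t : ℝ) (p : M), (shearFactor (A p) (J p) t).IsInvertible) :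
    ContMDiff (𝓘(ℝ, ℝ).prod 𝓘(ℝ, Model m)) (𝓘(ℝ, Model m).prod 𝓘(ℝ, Model m →L[ℝ] Model m)) ∞
      (fun x : ℝ × M => TotalSpace.mk' (Model m →L[ℝ] Model m)
        (E := fun p : M => TanSp m p →L[ℝ] TanSp m p) x.2 (shearConj (A x.2) (J x.2) x.1)) := by
  rintro ⟨t, p⟩
  rw [← contMDiffWithinAt_univ, contMDiffWithinAt_endField_iff]
  refine ⟨contMDiffWithinAt_snd, ?_⟩
  rw [contMDiffWithinAt_univ]
  set e := trivializationAt (Model m) (TangentSpace 𝓘(ℝ, Model m) : M → Type _) p with he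
  have hp : p ∈ e.baseSet := mem_baseSet_trivializationAt _ _ p
  have hAc : ContMDiffAt 𝓘(ℝ, Model m) 𝓘(ℝ, Model m →L[ℝ] Model m) ∞
      (fun q => endCoord p q (A q)) p :=
    ((contMDiffWithinAt_endField_iff.1 (hA p (mem_univ p))).2).contMDiffAt Filter.univ_mem
  have hJc : ContMDiffAt 𝓘(ℝ, Model m) 𝓘(ℝ, Model m →L[ℝ] Model m) ∞
      (fun q => endCoord p q (J q)) p :=
    ((contMDiffWithinAt_endField_iff.1 (hJ p (mem_univ p))).2).contMDiffAt Filter.univ_mem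
  have hAc' := ContMDiffAt.comp (t, p) (g := fun q => endCoord p q (A q)) (f := Prod.snd)
    (I := 𝓘(ℝ, ℝ).prod 𝓘(ℝ, Model m)) hAc contMDiffAt_snd
  have hJc' := ContMDiffAt.comp (t, p) (g := fun q => endCoord p q (J q)) (f := Prod.snd)
    (I := 𝓘(ℝ, ℝ).prod 𝓘(ℝ, Model m)) hJc contMDiffAt_snd
  set F : ℝ × M → Model m →L[ℝ] Model m := fun x =>
    shearFactor (endCoord p x.2 (A x.2)) (endCoord p x.2 (J x.2)) x.1 with hF
  have hFs : ContMDiffAt (𝓘(ℝ, ℝ).prod 𝓘(ℝ, Model m)) 𝓘(ℝ, Model m →L[ℝ] Model m) ∞ F (t, p) :=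
    contMDiffAt_const.sub (contMDiffAt_fst.smul (hAc'.clm_comp hJc'))
  have hFeq : ∀ x : ℝ × M, x.2 ∈ e.baseSet →
      F x = endCoord p x.2 (shearFactor (A x.2) (J x.2) x.1) := by
    intro x hx
    ext1 v
    simp only [hF, shearFactor_apply, endCoord_apply hx, map_sub, map_smul,
      ContinuousLinearEquiv.symm_apply_apply, ContinuousLinearEquiv.apply_symm_apply]
  have hFinv : ∀ x : ℝ × M, x.2 ∈ e.baseSet → (F x).IsInvertible := by
    intro x hx
    obtain ⟨L, hL⟩ := hinv x.1 x.2
    refine ⟨((fiberEquiv p hx).symm.trans L).trans (fiberEquiv p hx), ?_⟩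
    rw [hFeq x hx, ← hL]
    ext1 v
    simp [endCoord_apply hx]
  have hconj : ∀ x : ℝ × M, x.2 ∈ e.baseSet →
      endCoord p x.2 (shearConj (A x.2) (J x.2) x.1) =
        (F x).comp ((endCoord p x.2 (J x.2)).comp (F x).inverse) := by
    intro x hx
    have h1 : ∀ v, (F x).inverse v = fiberEquiv p hx
        ((shearFactor (A x.2) (J x.2) x.1).inverse ((fiberEquiv p hx).symm v)) := by
      intro v
      rw [(hFinv x hx).inverse_apply_eq, hFeq x hx, endCoord_apply hx,
        ContinuousLinearEquiv.symm_apply_apply]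
      obtain ⟨L, hL⟩ := hinv x.1 x.2
      rw [← hL, ContinuousLinearMap.inverse_equiv]
      simp
    ext1 v
    simp only [ContinuousLinearMap.comp_apply, h1]
    simp only [ContinuousLinearMap.comp_apply, shearConj, hFeq x hx, endCoord_apply hx,
      ContinuousLinearEquiv.symm_apply_apply]
  -- Inversion of operators is smooth at an invertible operator.
  have hFi : ContMDiffAt (𝓘(ℝ, ℝ).prod 𝓘(ℝ, Model m)) 𝓘(ℝ, Model m →L[ℝ] Model m) ∞
      (fun x => (F x).inverse) (t, p) := by
    obtain ⟨L, hL⟩ := hFinv (t, p) hp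
    have h1 : ContMDiffAt 𝓘(ℝ, Model m →L[ℝ] Model m) 𝓘(ℝ, Model m →L[ℝ] Model m) ∞
        ContinuousLinearMap.inverse (F (t, p)) := by
      rw [← hL]; exact (contDiffAt_map_inverse L).contMDiffAt
    exact h1.comp (t, p) hFs
  refine (hFs.clm_comp (hJc'.clm_comp hFi)).congr_of_eventuallyEq ?_
  have hnhds : ∀ᶠ x : ℝ × M in 𝓝 (t, p), x.2 ∈ e.baseSet :=
    continuousAt_snd.eventually (e.open_baseSet.mem_nhds hp)
  filter_upwards [hnhds] with x hx using hconj x hx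

/-- Integrability is a local property. -/
theorem IntegrableOnSet.mono [T2Space M] {J J' : EndField m M} {U : Set M} (hU : IsOpen U)
    (hJ : IntegrableOnSet univ J) (hJJ' : ∀ q ∈ U, J' q = J q) : IntegrableOnSet U J' := by
  intro X Y hX hY p hp
  -- Fields on `U` need not extend to M. Cutting them off by a bump function supported in `U` and
  -- equal to 1 near p gives global fields with the same germs, which determine the brackets.
  obtain ⟨f, -, hf⟩ := ((SmoothBumpFunction.nhds_basis_tsupport (I := 𝓘(ℝ, Model m)) p).mem_iff).1
    (hU.mem_nhds hp)
  have hext : ∀ X : VecField m M, SmoothVecOn U X → SmoothVecOn univ (fun q => f q • X q) :=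
    fun X hX => (ContMDiffOn.smul_section_of_tsupport (V := TangentSpace 𝓘(ℝ, Model m))
      f.contMDiff.contMDiffOn hU hf hX).contMDiffOn
  obtain ⟨W, hW, hfW⟩ := f.eventuallyEq_one.exists_mem
  have hWU : U ∩ W ∈ 𝓝 p := Filter.inter_mem (hU.mem_nhds hp) hW
  have hXe : ∀ q ∈ U ∩ W, X q = f q • X q := fun q hq => by simp [hfW hq.2]
  have hYe : ∀ q ∈ U ∩ W, Y q = f q • Y q := fun q hq => by simp [hfW hq.2]
  have hJXe : ∀ q ∈ U ∩ W, J' q (X q) = J q (f q • X q) :=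
    fun q hq => by simp [hfW hq.2, hJJ' q hq.1]
  have hJYe : ∀ q ∈ U ∩ W, J' q (Y q) = J q (f q • Y q) :=
    fun q hq => by simp [hfW hq.2, hJJ' q hq.1]
  rw [bracket_congr hWU hJXe hJYe, bracket_congr hWU hJXe hYe, bracket_congr hWU hXe hJYe,
    bracket_congr hWU hXe hYe, hJJ' p hp]
  exact hJ _ _ (hext X hX) (hext Y hY) p (mem_univ p)

theorem IntegrableOnSet.neg {J : EndField m M} (hJs : SmoothEndOn univ J)
    (hJ : IntegrableOnSet univ J) : IntegrableOnSet univ (fun p => -J p) := by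
  intro X Y hX hY p hp
  have h := hJ X Y hX hY p hp
  have hn : ∀ X : VecField m M, (fun q => (-J q) (X q)) = fun q => (-1 : ℝ) • J q (X q) := by
    intro X; funext q; simp
  rw [hn, hn, bracket_const_smul_left _ (hJs.apply hX), bracket_const_smul_right _ (hJs.apply hY),
    bracket_const_smul_left _ (hJs.apply hX), bracket_const_smul_right _ (hJs.apply hY)]
  simpa using h

end Sections
end

/-! ### The global deformation and its membership in DGK. -/

noncomputable section

set_option linter.unusedSectionVars false

/-- The formula F_t⁻¹ = 1 + tAJ_t, which makes F_t⁻¹ of a smooth field visibly smooth. -/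
theorem ShearData.shearFactor_add_shear {V : Type*} [TopologicalSpace V] [AddCommGroup V]
    [Module ℝ V] [IsTopologicalAddGroup V] [ContinuousSMul ℝ V] {w : V →L[ℝ] V →L[ℝ] ℝ}
    {J A : V →L[ℝ] V} (h : ShearData w J A) [T2Space V] [FiniteDimensional ℝ V] (t : ℝ) (X : V) :
    shearFactor A J t (X + t • A (shearConj A J t X)) = X := by
  obtain ⟨Y, rfl⟩ := h.shearFactor_surjective t X
  rw [h.shearConj_shearFactor, h.shearFactor_complex, map_add A, map_smul A, h.nilpotent,
    smul_zero, add_zero]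
  congr 1
  rw [shearFactor_apply, sub_add_cancel]

namespace SymplecticToric

variable {m : ℕ} {M : Type*} [TopologicalSpace M] [ChartedSpace (Model m) M]
  [IsManifold 𝓘(ℝ, Model m) ∞ M] [MulAction (Torus m) M]

instance (p : M) : FiniteDimensional ℝ (TanSp m p) :=
  inferInstanceAs (FiniteDimensional ℝ (Model m))

instance (p : M) : T2Space (TanSp m p) := inferInstanceAs (T2Space (Model m))

/-- Linearity in v is read off from dμ^v = -ω(v^♯, ·). -/
theorem dfun_moment_sum (T : SymplecticToric m M) {ι : Type*} (s : Finset ι) (c : ι → ℝ)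
    (v : ι → TorusLie m) (p : M) (X : TanSp m p) :
    dfun (fun q => T.moment q (∑ j ∈ s, c j • v j)) p X =
      ∑ j ∈ s, c j * dfun (fun q => T.moment q (v j)) p X := by
  have h : ∀ v, dfun (fun q => T.moment q v) p X = -T.sympl p (infActionL p v) X := fun v => by
    rw [infActionL_apply, T.moment_hamiltonian, neg_neg]
  refine (h _).trans (Eq.trans ?_ (Finset.sum_congr rfl fun j _ => by rw [h (v j)]).symm)
  simp only [map_sum, map_smul, sum_apply, smul_apply, smul_eq_mul, mul_neg,
    Finset.sum_neg_distrib]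

variable (T : SymplecticToric m M) (ξ : Fin m → TorusLie m) (C : Matrix (Fin m) (Fin m) ℝ)

/-- The field of endomorphisms `∑ C i j K_{ξ i} ⊗ dμ^{ξ j}`. -/
def matShear : EndField m M := T.shear ξ fun i => ∑ j, C i j • ξ j

theorem matShear_apply (p : M) (X : TanSp m p) :
    T.matShear ξ C p X = ∑ i, (∑ j, C i j * dfun (fun q => T.moment q (ξ j)) p X) •
      infAction (ξ i) p := by
  simp only [matShear, shear_apply, weightedSum, T.dfun_moment_sum]

theorem sympl_matShear (p : M) (X Y : TanSp m p) :
    T.sympl p (T.matShear ξ C p X) Y = -∑ i, ∑ j, C i j *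
      (dfun (fun q => T.moment q (ξ j)) p X * dfun (fun q => T.moment q (ξ i)) p Y) := by
  rw [matShear_apply]
  simp only [map_sum, map_smul, sum_apply, smul_apply, smul_eq_mul, T.moment_hamiltonian,
    mul_neg, Finset.sum_neg_distrib, Finset.sum_mul, mul_assoc]

theorem sympl_skew (p : M) (X Y : TanSp m p) : T.sympl p X Y = -T.sympl p Y X := by
  have := T.sympl_alt p (X + Y)
  simp only [map_add, add_apply, T.sympl_alt] at this
  linarith

variable {C}

/-- Nilpotence comes from dμ(K) = 0. Self-adjointness comes from ω(A·, ·) = -∑ C_ij dμ^j ⊗ dμ^i, a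
form that is skew exactly as needed because C is. -/
theorem shearData (hC : C.transpose = -C) {J₀ : EndField m M} (hJ₀ : T.IsKahler J₀) (p : M) :
    ShearData (T.sympl p) (J₀ p) (T.matShear ξ C p) where
  alt := T.sympl_alt p
  sq := hJ₀.1.2 p (mem_univ p)
  tamed := hJ₀.2.2.2.1 p (mem_univ p)
  compat := hJ₀.2.2.2.2 p
  nilpotent X := by
    rw [T.matShear_apply ξ C p X, map_sum]
    refine Finset.sum_eq_zero fun i _ => ?_
    rw [map_smul, matShear_apply]
    simp [T.dfun_moment_infAction]
  adjoint X Y := by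
    rw [T.sympl_skew p X, sympl_matShear, sympl_matShear, neg_neg, Finset.sum_comm,
      ← Finset.sum_neg_distrib]
    refine Finset.sum_congr rfl fun i _ => ?_
    rw [← Finset.sum_neg_distrib]
    refine Finset.sum_congr rfl fun j _ => ?_
    have h : C j i = -C i j := congrFun (congrFun hC i) j
    rw [h]; ring

theorem matShear_mem (p : M) (X : TanSp m p) : T.matShear ξ C p X ∈ T.orbitDistribution p := by
  rw [matShear_apply]
  exact Submodule.sum_mem _ fun i _ => Submodule.smul_mem _ _ (Submodule.subset_span ⟨ξ i, rfl⟩)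

theorem matShear_orbit (p : M) (X : TanSp m p) (hX : X ∈ T.orbitDistribution p) :
    T.matShear ξ C p X = 0 := by
  have h : T.orbitDistribution p ≤ LinearMap.ker (T.matShear ξ C p).toLinearMap := by
    refine Submodule.span_le.2 ?_
    rintro _ ⟨v, rfl⟩
    simp [matShear_apply, T.dfun_moment_infAction]
  exact h hX

theorem matShear_smul (g : Torus m) (p : M) (X : TanSp m p) :
    mfderiv 𝓘(ℝ, Model m) 𝓘(ℝ, Model m) (fun q : M => g • q) p (T.matShear ξ C p X) =
      T.matShear ξ C (g • p) (mfderiv 𝓘(ℝ, Model m) 𝓘(ℝ, Model m) (fun q : M => g • q) p X) := by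
  rw [matShear_apply, matShear_apply]
  simp only [map_sum, map_smul, ← T.infAction_smul]
  refine Finset.sum_congr rfl fun i _ => ?_
  congr 1
  refine Finset.sum_congr rfl fun j _ => ?_
  rw [T.dfun_smul (T.contMDiff_moment _) fun g q => by rw [T.moment_invariant]]

theorem smooth_matShear : SmoothEndOn univ (T.matShear ξ C) :=
  smoothEndOn_of_apply fun _ _ _ hX => T.smooth_shear_apply _ _ hX

variable (C) in
/-- The deformation of `J₀` along the constant matrix `C`. -/
def deform (J₀ : EndField m M) (t : ℝ) : EndField m M := fun p =>
  shearConj (T.matShear ξ C p) (J₀ p) t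

section

variable (hC : C.transpose = -C) {J₀ : EndField m M} (hJ₀ : T.IsKahler J₀)
include hC hJ₀

theorem contMDiff_deform :
    ContMDiff (𝓘(ℝ, ℝ).prod 𝓘(ℝ, Model m)) (𝓘(ℝ, Model m).prod 𝓘(ℝ, Model m →L[ℝ] Model m)) ∞
      (fun x : ℝ × M => TotalSpace.mk' (Model m →L[ℝ] Model m)
        (E := fun p : M => TanSp m p →L[ℝ] TanSp m p) x.2 (T.deform ξ C J₀ x.1 x.2)) :=
  contMDiff_shearConj (T.smooth_matShear ξ) hJ₀.1.1
    fun t p => (T.shearData ξ hC hJ₀ p).shearFactor_isInvertible t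

theorem smooth_deform (t : ℝ) : SmoothEndOn univ (T.deform ξ C J₀ t) :=
  ((T.contMDiff_deform ξ hC hJ₀).comp
    (contMDiff_const.prodMk contMDiff_id : ContMDiff 𝓘(ℝ, Model m) (𝓘(ℝ, ℝ).prod 𝓘(ℝ, Model m)) ∞
      fun p : M => (t, p))).contMDiffOn

theorem deform_invariant (t : ℝ) : T.InvariantOn univ (T.deform ξ C J₀ t) := by
  intro g p _ X
  have hF : ∀ X, mfderiv 𝓘(ℝ, Model m) 𝓘(ℝ, Model m) (fun q : M => g • q) p
      (shearFactor (T.matShear ξ C p) (J₀ p) t X) =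
      shearFactor (T.matShear ξ C (g • p)) (J₀ (g • p)) t
        (mfderiv 𝓘(ℝ, Model m) 𝓘(ℝ, Model m) (fun q : M => g • q) p X) := by
    intro X
    rw [shearFactor_apply, shearFactor_apply, map_sub, map_smul, T.matShear_smul,
      hJ₀.2.2.1 g p (mem_univ p)]
  obtain ⟨Y, rfl⟩ := (T.shearData ξ hC hJ₀ p).shearFactor_surjective t X
  rw [deform, (T.shearData ξ hC hJ₀ p).shearConj_shearFactor, hF, hF, deform,
    (T.shearData ξ hC hJ₀ (g • p)).shearConj_shearFactor, hJ₀.2.2.1 g p (mem_univ p)]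

theorem deform_integrable (t : ℝ) : IntegrableOnSet univ (T.deform ξ C J₀ t) := by
  -- Substituting X = F_t X' gives J_t X = F_t J₀X' and removes the inverse from the Nijenhuis
  -- tensor.
  have key : ∀ X : VecField m M, SmoothVecOn univ X → ∃ X' : VecField m M, SmoothVecOn univ X' ∧
      X = (fun q => X' q + (-t) • T.matShear ξ C q (J₀ q (X' q))) ∧
      (fun q => T.deform ξ C J₀ t q (X q)) = fun q => J₀ q (X' q) + t • T.matShear ξ C q (X' q) := by
    intro X hX
    refine ⟨fun q => X q + t • T.matShear ξ C q (T.deform ξ C J₀ t q (X q)),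
      hX.add (((T.smooth_matShear ξ).apply ((T.smooth_deform ξ hC hJ₀ t).apply hX)).const_smul t),
      ?_, ?_⟩
    · funext q
      rw [neg_smul, ← sub_eq_add_neg, ← shearFactor_apply]
      exact ((T.shearData ξ hC hJ₀ q).shearFactor_add_shear t _).symm
    · funext q
      rw [← (T.shearData ξ hC hJ₀ q).shearFactor_complex,
        ← (T.shearData ξ hC hJ₀ q).shearConj_shearFactor]
      conv_lhs => rw [← (T.shearData ξ hC hJ₀ q).shearFactor_add_shear t (X q)]
      rfl
  intro X Y hX hY p _
  obtain ⟨X', hX', hXe, hJX⟩ := key X hX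
  obtain ⟨Y', hY', hYe, hJY⟩ := key Y hY
  rw [hJX, hJY, hXe, hYe]
  obtain ⟨V, h1, h2⟩ := T.bracket_shear_integrable ξ (fun i => ∑ j, C i j • ξ j) hJ₀.1 hJ₀.2.1
    hJ₀.2.2.1 t hX' hY' p
  have h3 := (T.shearData ξ hC hJ₀ p).shearConj_shearFactor t V
  rw [shearFactor_apply, (T.shearData ξ hC hJ₀ p).shearFactor_complex] at h3
  have e : ∀ a b c d : TanSp m p, a - T.deform ξ C J₀ t p b - T.deform ξ C J₀ t p c - d =
      (a - d) - T.deform ξ C J₀ t p (b + c) := by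
    intro a b c d
    rw [map_add]; abel
  rw [e]
  refine sub_eq_zero.2 ?_
  exact h2.trans (h3.symm.trans (congrArg _ h1.symm))

theorem deform_adjoint (t : ℝ) :
    T.IsAdjointOn univ (T.deform ξ C J₀ t) fun p => -T.deform ξ C J₀ (-t) p :=
  fun p _ X Y => (T.shearData ξ hC hJ₀ p).shearConj_adjoint t X Y

theorem deform_map_orbit (t : ℝ) (p : M) :
    (T.orbitDistribution p).map (T.deform ξ C J₀ t p).toLinearMap =
      (T.orbitDistribution p).map (J₀ p).toLinearMap :=
  (T.shearData ξ hC hJ₀ p).map_shearConj (T.matShear_mem ξ p) (T.matShear_orbit ξ p) t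

/-- Serves both M and M°: on M° the anti-diagonal field agrees with the deformation, and its
meaningless values elsewhere play no role. -/
theorem isDGKOn_of_eq_deform [T2Space M] {U : Set M} (hU : IsOpen U)
    (hUinv : ∀ (g : Torus m), ∀ p ∈ U, g • p ∈ U) (t : ℝ) {J : EndField m M}
    (hJ : ∀ p ∈ U, J p = T.deform ξ C J₀ t p) : T.IsDGKOn U J := by
  have hadj : T.IsAdjointOn U J fun p => -T.deform ξ C J₀ (-t) p := by
    intro p hp X Y
    rw [hJ p hp]
    exact T.deform_adjoint ξ hC hJ₀ t p (mem_univ p) X Y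
  refine ⟨⟨⟨?_, ?_⟩, ?_, ?_, ?_, _, hadj, ?_⟩, _, hadj, ?_⟩
  · exact ((T.smooth_deform ξ hC hJ₀ t).mono (subset_univ U)).congr fun p hp => by rw [hJ p hp]
  · intro p hp X
    rw [hJ p hp]
    exact (T.shearData ξ hC hJ₀ p).shearConj_sq t X
  · intro p hp X hX
    rw [hJ p hp]
    exact (T.shearData ξ hC hJ₀ p).shearConj_tamed t X hX
  · intro g p hp X
    rw [hJ p hp, hJ _ (hUinv g p hp)]
    exact T.deform_invariant ξ hC hJ₀ t g p (mem_univ p) X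
  · exact (T.deform_integrable ξ hC hJ₀ t).mono hU hJ
  · exact (IntegrableOnSet.neg (T.smooth_deform ξ hC hJ₀ (-t))
      (T.deform_integrable ξ hC hJ₀ (-t))).mono hU fun _ _ => rfl
  · intro p hp
    rw [hJ p hp.1, T.deform_map_orbit ξ hC hJ₀]
    have h : (-T.deform ξ C J₀ (-t) p).toLinearMap = -(T.deform ξ C J₀ (-t) p).toLinearMap := rfl
    rw [h, Submodule.map_neg, T.deform_map_orbit ξ hC hJ₀]

end

end SymplecticToric
end

/-! ### Comparison with the anti-diagonal form on M°. -/

noncomputable section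

set_option linter.unusedSectionVars false

namespace SymplecticToric

variable {m : ℕ} {M : Type*} [TopologicalSpace M] [ChartedSpace (Model m) M]
  [IsManifold 𝓘(ℝ, Model m) ∞ M] [MulAction (Torus m) M]

/-- The skew part does not contribute to the quadratic form, so x·(S + tC)x = x·Sx > 0 for x ≠ 0. -/
theorem isUnit_det_posDef_add_skew {S C : Matrix (Fin m) (Fin m) ℝ} (hS : S.PosDef)
    (hC : C.transpose = -C) (t : ℝ) : IsUnit (S + t • C).det := by
  rw [← Matrix.isUnit_iff_isUnit_det, ← Matrix.mulVec_injective_iff_isUnit]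
  rw [← Matrix.coe_mulVecLin, injective_iff_map_eq_zero]
  intro x hx
  by_contra hne
  have h1 := hS.dotProduct_mulVec_pos hne
  have h2 : x ⬝ᵥ C.mulVec x = 0 := by
    have : x ⬝ᵥ C.mulVec x = -(x ⬝ᵥ C.mulVec x) := by
      conv_lhs => rw [Matrix.dotProduct_mulVec, ← Matrix.mulVec_transpose, hC, Matrix.neg_mulVec,
        neg_dotProduct, dotProduct_comm]
    linarith
  have h3 : x ⬝ᵥ (S + t • C).mulVec x = 0 := by
    rw [Matrix.mulVecLin_apply] at hx
    rw [hx, dotProduct_zero]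
  rw [Matrix.add_mulVec, dotProduct_add, Matrix.smul_mulVec, dotProduct_smul, h2] at h3
  simp at h1 h3
  linarith

theorem antiDiag_apply {T : SymplecticToric m M} {ξ : Module.Basis (Fin m) ℝ (TorusLie m)}
    (c : T.AdmissibleCoords ξ) (Ψ : M → Matrix (Fin m) (Fin m) ℝ) (p : M) (X : TanSp m p) :
    c.antiDiag Ψ p X =
      weightedSum ((Ψ p).mulVec fun j => dfun (fun q => T.moment q (ξ j)) p X)
        (fun i => infAction (ξ i) p) -
      weightedSum ((Ψ p)⁻¹.mulVec fun j => dfun (c.t p j) p X) (fun i => c.dmuVec i p) := by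
  simp only [AdmissibleCoords.antiDiag, weightedSum, Matrix.mulVec, dotProduct, sub_apply,
    sum_apply, smul_apply, ContinuousLinearMap.smulRight_apply, Finset.sum_smul, smul_smul]

theorem weightedSum_ite {a : Fin m → ℝ} (i : Fin m) :
    weightedSum a (fun j => if i = j then (1 : ℝ) else 0) = a i := by
  simp [weightedSum]

/-- Compare the two on vectors F_t X, where the deformation gives J₀X + tAX. F_t leaves dμ unchanged
and replaces dt by (1 + tCS⁻¹)dt = (S + tC)S⁻¹dt, whose prefactor the inverse of S + tC cancels. -/
theorem antiDiag_eq_deform {T : SymplecticToric m M} {ξ : Module.Basis (Fin m) ℝ (TorusLie m)}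
    (c : T.AdmissibleCoords ξ) {J₀ : EndField m M} (hJ₀ : T.IsKahler J₀)
    {S : M → Matrix (Fin m) (Fin m) ℝ} {p : M} (hp : p ∈ T.interiorPart) (hS : (S p).PosDef)
    (hJ₀S : J₀ p = c.antiDiag S p) {C : Matrix (Fin m) (Fin m) ℝ} (hC : C.transpose = -C)
    (t : ℝ) : c.antiDiag (fun q => S q + t • C) p = T.deform ξ C J₀ t p := by
  obtain ⟨U, -, hpU, -, hU⟩ := c.t_spec p hp
  have htK : ∀ i j, dfun (c.t p i) p (infAction (ξ j) p) = if i = j then 1 else 0 :=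
    fun i j => ((hU i).2 p hpU j).1
  have hmd : ∀ i j, dfun (fun q => T.moment q (ξ i)) p (c.dmuVec j p) = if i = j then 1 else 0 :=
    fun i j => (c.dmuVec_spec p hp i j).1
  have hD := T.shearData ξ hC hJ₀ p
  have hμJ : ∀ X, (fun j => dfun (fun q => T.moment q (ξ j)) p (J₀ p X)) =
      -(S p)⁻¹.mulVec fun j => dfun (c.t p j) p X := by
    intro X
    funext j
    rw [hJ₀S, antiDiag_apply, map_sub, map_weightedSum, map_weightedSum]
    simp only [T.dfun_moment_infAction, hmd, weightedSum_zero_right, weightedSum_ite]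
    simp
  have hA : ∀ X, T.matShear ξ C p X = weightedSum
      (C.mulVec fun j => dfun (fun q => T.moment q (ξ j)) p X) (fun i => infAction (ξ i) p) := by
    intro X
    rw [matShear_apply]; rfl
  have hSu : IsUnit (S p).det := by simpa using isUnit_det_posDef_add_skew hS hC 0
  have hΨ := isUnit_det_posDef_add_skew hS hC t
  ext1 X
  obtain ⟨X, rfl⟩ := hD.shearFactor_surjective t X
  rw [deform, hD.shearConj_shearFactor, hD.shearFactor_complex, antiDiag_apply]
  have h1 : (fun j => dfun (fun q => T.moment q (ξ j)) p
      (shearFactor (T.matShear ξ C p) (J₀ p) t X)) =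
      fun j => dfun (fun q => T.moment q (ξ j)) p X := by
    funext j
    rw [shearFactor_apply, map_sub, map_smul, hA, map_weightedSum]
    simp only [T.dfun_moment_infAction, weightedSum_zero_right, smul_zero, sub_zero]
  have h2 : (fun j => dfun (c.t p j) p (shearFactor (T.matShear ξ C p) (J₀ p) t X)) =
      (fun j => dfun (c.t p j) p X) +
        t • C.mulVec ((S p)⁻¹.mulVec fun j => dfun (c.t p j) p X) := by
    funext j
    rw [shearFactor_apply, map_sub, map_smul, hA, map_weightedSum, hμJ, Matrix.mulVec_neg]
    simp only [htK, weightedSum_ite]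
    simp
  have h3 : (S p + t • C)⁻¹.mulVec ((fun j => dfun (c.t p j) p X) +
        t • C.mulVec ((S p)⁻¹.mulVec fun j => dfun (c.t p j) p X)) =
      (S p)⁻¹.mulVec fun j => dfun (c.t p j) p X := by
    generalize (fun j => dfun (c.t p j) p X) = x
    have e : x + t • C.mulVec ((S p)⁻¹.mulVec x) = (S p + t • C).mulVec ((S p)⁻¹.mulVec x) := by
      rw [Matrix.add_mulVec, Matrix.mulVec_mulVec x (S p), Matrix.mul_nonsing_inv _ hSu,
        Matrix.one_mulVec, Matrix.smul_mulVec]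
    rw [e, Matrix.mulVec_mulVec, Matrix.nonsing_inv_mul _ hΨ, Matrix.one_mulVec]
  rw [h1, h2, h3, hA, hJ₀S, antiDiag_apply, Matrix.add_mulVec, Matrix.smul_mulVec]
  have h4 : ∀ (a b : Fin m → ℝ) (k : Fin m → TanSp m p),
      weightedSum (a + t • b) k = weightedSum a k + t • weightedSum b k := by
    intro a b k
    simp [weightedSum, add_smul, Finset.sum_add_distrib, Finset.smul_sum, smul_smul]
  rw [h4]
  abel

end SymplecticToric
end

/-! ### Effectiveness yields a point where the infinitesimal action is injective. -/

noncomputable section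

set_option linter.unusedSectionVars false

namespace SymplecticToric

variable {m : ℕ} {M : Type*} [TopologicalSpace M] [ChartedSpace (Model m) M]
  [IsManifold 𝓘(ℝ, Model m) ∞ M] [MulAction (Torus m) M]

/-- The sum of the translates of the chart at `p` under the powers of `g`. -/
def chartSum (p : M) (g : Torus m) (n : ℕ) (q : M) : Model m :=
  ∑ k ∈ Finset.range n, extChartAt 𝓘(ℝ, Model m) p (g ^ k • q)

theorem chartSum_smul (p : M) {g : Torus m} {n : ℕ} (hg : g ^ n = 1) (q : M) :
    chartSum p g n (g • q) = chartSum p g n q := by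
  have h := Finset.sum_range_succ' (fun k => extChartAt 𝓘(ℝ, Model m) p (g ^ k • q)) n
  rw [Finset.sum_range_succ] at h
  simp only [hg, pow_zero, add_left_inj] at h
  simp only [chartSum, ← mul_smul, ← pow_succ]
  exact h.symm

theorem contDiffAt_chartSum (T : SymplecticToric m M) {p : M} {g : Torus m} (hp : g • p = p)
    (n : ℕ) : ContDiffAt ℝ ∞ (fun y => chartSum p g n ((extChartAt 𝓘(ℝ, Model m) p).symm y))
      (extChartAt 𝓘(ℝ, Model m) p p) := by
  have hpow : ∀ k : ℕ, g ^ k • p = p := by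
    intro k
    induction k with
    | zero => simp
    | succ k ih => rw [pow_succ, mul_smul, hp, ih]
  refine ContDiffAt.sum fun k _ => ?_
  have h1 : ContMDiffAt 𝓘(ℝ, Model m) 𝓘(ℝ, Model m) ∞ (extChartAt 𝓘(ℝ, Model m) p).symm
      (extChartAt 𝓘(ℝ, Model m) p p) :=
    (contMDiffOn_extChartAt_symm (n := ∞) p).contMDiffAt
      (show (extChartAt 𝓘(ℝ, Model m) p).target ∈ 𝓝 (extChartAt 𝓘(ℝ, Model m) p p) from
        extChartAt_target_mem_nhds p)
  have h2 := ContMDiffAt.comp (extChartAt 𝓘(ℝ, Model m) p p) (T.contMDiff_smul (g ^ k) _) h1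
  refine (ContMDiffAt.comp (g := extChartAt 𝓘(ℝ, Model m) p) _ ?_ h2).contDiffAt
  simp only [Function.comp, extChartAt_to_inv, hpow]
  exact contMDiffAt_extChartAt

/-- The sum Φ of the n translates of the chart is g-invariant. At a limit of interior fixed points
its derivative is n times the identity, by continuity of the derivative. So Φ is injective near p,
and Φ(gq) = Φ(q) forces gq = q. -/
theorem mem_interior_fixedBy_of_mem_closure [T2Space M] (T : SymplecticToric m M) {g : Torus m}
    {n : ℕ} (hn : n ≠ 0) (hg : g ^ n = 1) {p : M}
    (hp : p ∈ closure (interior {q : M | g • q = q})) : p ∈ interior {q : M | g • q = q} := by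
  have hcl : IsClosed {q : M | g • q = q} :=
    isClosed_eq (T.contMDiff_smul g).continuous continuous_id
  have hgp : g • p = p := (closure_minimal interior_subset hcl) hp
  set e := extChartAt 𝓘(ℝ, Model m) p with he
  set Φ : Model m → Model m := fun y => chartSum p g n (e.symm y) with hΦ
  have hcd : ContDiffAt ℝ ∞ Φ (e p) := T.contDiffAt_chartSum hgp n
  have hsymm : ContinuousAt e.symm (e p) := continuousAt_extChartAt_symm p
  have he' : ContinuousAt e p := continuousAt_extChartAt p
  have hfix : ∀ q ∈ interior {q : M | g • q = q}, ∀ k : ℕ, g ^ k • q = q := by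
    intro q hq k
    have hq' : q ∈ {q : M | g • q = q} := interior_subset hq
    rw [mem_ofPred_eq] at hq'
    induction k with
    | zero => simp
    | succ k ih => rw [pow_succ, mul_smul, hq', ih]
  have hderiv : fderiv ℝ Φ (e p) = (n : ℝ) • ContinuousLinearMap.id ℝ (Model m) := by
    refine tendsto_nhds_unique_of_frequently_eq
      (hcd.fderiv_right (m := 0) (by simp)).continuousAt (tendsto_const_nhds (x := _)) ?_
    have h1 : ∃ᶠ q in 𝓝 p, q ∈ interior {q : M | g • q = q} ∧ q ∈ e.source :=
      (mem_closure_iff_frequently.1 hp).and_eventually (extChartAt_source_mem_nhds p)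
    refine he'.tendsto.frequently (h1.mono fun q hq => ?_)
    have h2 : Φ =ᶠ[𝓝 (e q)] fun y => (n : ℝ) • y := by
      have ht : e.target ∈ 𝓝 (e q) := extChartAt_target_mem_nhds' (e.map_source hq.2)
      have hs : e.symm ⁻¹' interior {q : M | g • q = q} ∈ 𝓝 (e q) := by
        refine (continuousAt_extChartAt_symm' hq.2).preimage_mem_nhds ?_
        rw [← he, e.left_inv hq.2]
        exact isOpen_interior.mem_nhds hq.1
      filter_upwards [ht, hs] with y hy hy'
      simp only [hΦ, chartSum, hfix _ hy', ← he, e.right_inv hy, Finset.sum_const,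
        Finset.card_range, Nat.cast_smul_eq_nsmul]
    rw [h2.fderiv_eq]
    exact ((hasFDerivAt_id _).const_smul (n : ℝ)).fderiv
  have hstrict := hcd.hasStrictFDerivAt (by simp)
  rw [hderiv] at hstrict
  -- Any constant below 1 works: when the values of Φ agree, n‖e(gq) - e(q)‖ ≤ c‖e(gq) - e(q)‖ with
  -- n ≥ 1.
  have hlo := (hstrict.isLittleO).def (c := 1 / 2) (by norm_num)
  have hgc : ContinuousAt (fun q : M => g • q) p := (T.contMDiff_smul g).continuous.continuousAt
  have hge : Filter.Tendsto (fun q : M => e (g • q)) (𝓝 p) (𝓝 (e p)) := by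
    have : Filter.Tendsto (fun q : M => g • q) (𝓝 p) (𝓝 p) := by
      simpa [ContinuousAt, hgp] using hgc
    exact he'.tendsto.comp this
  have hsg : ∀ᶠ q in 𝓝 p, g • q ∈ e.source :=
    hgc.preimage_mem_nhds (by rw [hgp]; exact extChartAt_source_mem_nhds p)
  have hs : ∀ᶠ q in 𝓝 p, q ∈ e.source := extChartAt_source_mem_nhds p
  rw [mem_interior_iff_mem_nhds]
  filter_upwards [(hge.prodMk_nhds he'.tendsto).eventually hlo, hsg, hs] with q h1 h2 h3
  refine e.injOn h2 h3 ?_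
  have h4 : Φ (e (g • q)) = Φ (e q) := by
    simp only [hΦ, e.left_inv h2, e.left_inv h3, chartSum_smul p hg]
  simp only [h4, sub_self, zero_sub, norm_neg, smul_apply, ContinuousLinearMap.id_apply,
    norm_smul, Real.norm_natCast] at h1
  have hn1 : (1 : ℝ) ≤ n := by exact_mod_cast Nat.one_le_iff_ne_zero.2 hn
  have h5 := norm_nonneg (e (g • q) - e q)
  have h6 : ‖e (g • q) - e q‖ = 0 := by nlinarith
  exact sub_eq_zero.1 (norm_eq_zero.1 h6)

/-- The interior of the fixed set is clopen. By connectedness it is empty or everything, and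
effectiveness excludes the latter. -/
theorem interior_fixedBy_eq_empty [T2Space M] [ConnectedSpace M] (T : SymplecticToric m M)
    {g : Torus m} {n : ℕ} (hn : n ≠ 0) (hg : g ^ n = 1) (h1 : g ≠ 1) :
    interior {q : M | g • q = q} = ∅ := by
  have hcl : IsClosed (interior {q : M | g • q = q}) :=
    isClosed_of_closure_subset fun p hp => T.mem_interior_fixedBy_of_mem_closure hn hg hp
  rcases isClopen_iff.1 ⟨hcl, isOpen_interior⟩ with h | h
  · exact h
  · refine absurd (T.action_effective g fun p => ?_) h1
    have hp : p ∈ interior {q : M | g • q = q} := h ▸ mem_univ p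
    have hp' : p ∈ {q : M | g • q = q} := interior_subset hp
    exact hp'

/-- Some point is fixed by no element of finite order. -/
theorem exists_smul_ne [T2Space M] [CompactSpace M] [ConnectedSpace M] (T : SymplecticToric m M) :
    ∃ p : M, ∀ (z : Fin m → ℤ) (n : ℕ), n ≠ 0 →
      torusExp (fun j => 2 * Real.pi * z j / n) ≠ 1 →
      torusExp (fun j => 2 * Real.pi * z j / n) • p ≠ p := by
  let ι := {x : (Fin m → ℤ) × ℕ // x.2 ≠ 0 ∧
    torusExp (fun j => 2 * Real.pi * x.1 j / x.2) ≠ 1}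
  -- Baire: there are countably many elements of finite order, and each nontrivial one moves an open
  -- dense set of points.
  have hd : Dense (⋂ x : ι, {q : M | torusExp (fun j => 2 * Real.pi * x.1.1 j / x.1.2) • q = q}ᶜ) := by
    refine dense_iInter_of_isOpen (fun x => ?_) fun x => ?_
    · exact (isClosed_eq (T.contMDiff_smul _).continuous continuous_id).isOpen_compl
    · rw [← interior_eq_empty_iff_dense_compl]
      refine T.interior_fixedBy_eq_empty x.2.1 ?_ x.2.2
      funext j
      have h0 : (x.1.2 : ℝ) ≠ 0 := by exact_mod_cast x.2.1
      rw [Pi.pow_apply, torusExp, ← Circle.exp_nsmul, Pi.one_apply, Circle.exp_eq_one]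
      exact ⟨x.1.1 j, by rw [nsmul_eq_mul]; field_simp⟩
  obtain ⟨p, hp⟩ := hd.nonempty
  exact ⟨p, fun z n hn h1 => mem_iInter.1 hp ⟨(z, n), hn, h1⟩⟩

/-- If `v^♯` vanishes at `p` then the one-parameter group generated by `v` fixes `p`. -/
theorem torusExp_smul_eq_of_infAction_eq_zero [T2Space M] (T : SymplecticToric m M)
    {v : TorusLie m} {p : M} (h : infAction v p = 0) (s : ℝ) : torusExp (s • v) • p = p := by
  have : IsManifold 𝓘(ℝ, Model m) 1 M := .of_le (n := ∞) (by simp)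
  -- The orbit curve and the constant curve are integral curves of v^♯ through the same point, hence
  -- equal.
  have hγ : IsMIntegralCurve (I := 𝓘(ℝ, Model m)) (fun s : ℝ => torusExp (s • v) • p)
      (fun q => infAction v q) := by
    intro t
    set q := torusExp (t • v) • p with hq
    have h1 : HasMFDerivAt 𝓘(ℝ, ℝ) 𝓘(ℝ, TorusLie m) (fun s : ℝ => (s - t) • v) t
        ((1 : ℝ →L[ℝ] ℝ).smulRight v) :=
      (((hasFDerivAt_id t).sub_const t).smul_const v).hasMFDerivAt
    have h2 : ∀ w : TorusLie m, w = 0 → HasMFDerivAt 𝓘(ℝ, TorusLie m) 𝓘(ℝ, Model m)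
        (fun w : TorusLie m => torusExp w • q) w (infActionL q) := by
      rintro _ rfl
      exact ((T.contMDiff_torusExp_smul q).mdifferentiable (by simp) _).hasMFDerivAt
    have h3 := HasMFDerivAt.comp t (h2 ((t - t) • v) (by simp)) h1
    have h4 : (fun w : TorusLie m => torusExp w • q) ∘ (fun s : ℝ => (s - t) • v) =
        fun s : ℝ => torusExp (s • v) • p := by
      funext s
      simp only [Function.comp, hq, ← mul_smul, ← torusExp_add, ← add_smul, sub_add_cancel]
    rw [h4] at h3
    refine h3.congr_mfderiv ?_
    refine ContinuousLinearMap.ext fun x : ℝ => ?_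
    exact map_smul (infActionL q) x v
  have hc : IsMIntegralCurve (I := 𝓘(ℝ, Model m)) (fun _ : ℝ => p) (fun q => infAction v q) := by
    intro t
    refine (hasMFDerivAt_const (I := 𝓘(ℝ, ℝ)) (I' := 𝓘(ℝ, Model m)) p t).congr_mfderiv ?_
    refine ContinuousLinearMap.ext fun x : ℝ => ?_
    exact ((congrArg (fun w : Model m => x • w) h).trans (smul_zero x)).symm
  have hv : ContMDiff 𝓘(ℝ, Model m) (𝓘(ℝ, Model m).tangent) 1
      (fun q : M => (⟨q, infAction v q⟩ : TangentBundle 𝓘(ℝ, Model m) M)) :=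
    (contMDiffOn_univ.1 (T.infAction_smooth v)).of_le ENat.LEInfty.out
  exact congrFun (isMIntegralCurve_Ioo_eq_of_contMDiff_boundaryless (t₀ := 0) hv hγ hc
    (by simp [torusExp_zero])) s

theorem torusExp_two_pi_mul_int (z : Fin m → ℤ) :
    torusExp (fun j => 2 * Real.pi * (z j : ℝ)) = 1 := by
  funext j
  exact Circle.exp_eq_one.2 ⟨z j, by ring⟩

theorem hasFDerivAt_extChartAt_torusExp_smul (T : SymplecticToric m M) (p : M) :
    HasFDerivAt (fun u : TorusLie m => extChartAt 𝓘(ℝ, Model m) p (torusExp u • p))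
      ((mfderiv 𝓘(ℝ, Model m) 𝓘(ℝ, Model m) (extChartAt 𝓘(ℝ, Model m) p) p).comp
        (infActionL p) : TorusLie m →L[ℝ] Model m) 0 := by
  have : IsManifold 𝓘(ℝ, Model m) 1 M := .of_le (n := ∞) (by simp)
  have h0 : torusExp (0 : TorusLie m) • p = p := by simp [torusExp_zero]
  have h1 : ∀ q, q = p → HasMFDerivAt 𝓘(ℝ, Model m) 𝓘(ℝ, Model m) (extChartAt 𝓘(ℝ, Model m) p) q
      (mfderiv 𝓘(ℝ, Model m) 𝓘(ℝ, Model m) (extChartAt 𝓘(ℝ, Model m) p) p :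
        Model m →L[ℝ] Model m) := by
    rintro q rfl
    exact (mdifferentiableAt_extChartAt (I := 𝓘(ℝ, Model m))
      (mem_chart_source (Model m) q)).hasMFDerivAt
  have h2 := (T.contMDiff_torusExp_smul p).mdifferentiable (by simp) 0
  exact (HasMFDerivAt.comp (0 : TorusLie m) (h1 _ h0) h2.hasMFDerivAt).hasFDerivAt

/-- Some point has a discrete stabiliser. -/
theorem exists_infAction_injective [T2Space M] [CompactSpace M] [ConnectedSpace M]
    (T : SymplecticToric m M) : ∃ p : M, ∀ v : TorusLie m, infAction v p = 0 → v = 0 := by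
  have : IsManifold 𝓘(ℝ, Model m) 1 M := .of_le (n := ∞) (by simp)
  obtain ⟨p, hp⟩ := T.exists_smul_ne
  refine ⟨p, ?_⟩
  let L : TorusLie m →ₗ[ℝ] Model m := (infActionL p).toLinearMap
  have hL : ∀ v, L v = 0 → ∀ s : ℝ, torusExp (s • v) • p = p :=
    fun v hv s => T.torusExp_smul_eq_of_infAction_eq_zero hv s
  let K := LinearMap.range L
  obtain ⟨σ, hσ⟩ := L.rangeRestrict.exists_rightInverse_of_surjective L.range_rangeRestrict
  have hσ' : ∀ k, L (σ k) = k := fun k => congrArg Subtype.val (LinearMap.congr_fun hσ k)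
  -- The images, in the tangent space of the orbit, of the generators of the kernel lattice of exp.
  -- Linear independence of b over ℝ is injectivity of L.
  let b : Fin m → K := fun j => L.rangeRestrict (Pi.single j (2 * Real.pi))
  have hb : ∀ z : Fin m → ℤ, ∑ j, z j • b j =
      L.rangeRestrict (fun j => 2 * Real.pi * (z j : ℝ)) := by
    intro z
    simp only [b, ← map_zsmul, ← map_sum]
    congr 1
    funext j
    simp [Finset.sum_apply, Pi.single_apply, mul_comm]
  -- If x is in the span, σx differs from a vector of the kernel lattice by an element of ker L, so
  -- exp(σx) fixes p. But k ↦ exp(σk)·p has injective derivative at 0, so small k ≠ 0 move p.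
  have hdisc : DiscreteTopology (Submodule.span ℤ (range b)) := by
    refine discreteTopology_of_isOpen_singleton_zero ?_
    obtain ⟨F', hF, hinj⟩ : ∃ F' : K →L[ℝ] Model m, HasFDerivAt
        ((fun u : TorusLie m => extChartAt 𝓘(ℝ, Model m) p (torusExp u • p)) ∘ fun k : K => σ k)
        F' 0 ∧ Function.Injective F' := by
      refine ⟨_, HasFDerivAt.comp (0 : K) (f := fun k : K => σ k)
        (by rw [map_zero]; exact T.hasFDerivAt_extChartAt_torusExp_smul p)
        (LinearMap.toContinuousLinearMap σ).hasFDerivAt, fun k l hkl => ?_⟩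
      obtain ⟨D, hD⟩ := isInvertible_mfderiv_extChartAt (I := 𝓘(ℝ, Model m))
        (mem_extChartAt_source (I := 𝓘(ℝ, Model m)) p)
      have e : ∀ x, D x = mfderiv 𝓘(ℝ, Model m) 𝓘(ℝ, Model m) (extChartAt 𝓘(ℝ, Model m) p) p x :=
        fun x => by rw [← hD]; rfl
      have h1 : D (L (σ k)) = D (L (σ l)) := (e _).trans (hkl.trans (e _).symm)
      have h2 : L (σ k) = L (σ l) := D.injective h1
      rw [hσ', hσ'] at h2
      exact Subtype.ext h2
    obtain ⟨c, -, hc⟩ := LinearMap.exists_antilipschitzWith F'.toLinearMap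
      (LinearMap.ker_eq_bot.2 hinj)
    have hne := hF.eventually_ne (c := extChartAt 𝓘(ℝ, Model m) p p) ⟨c, hc⟩
    rw [eventually_nhdsWithin_iff] at hne
    have hsub : Filter.Tendsto (fun x : Submodule.span ℤ (range b) => (x : K)) (𝓝 0) (𝓝 0) :=
      continuous_subtype_val.tendsto _
    refine isOpen_iff_mem_nhds.2 fun x hx => ?_
    rw [mem_singleton_iff.1 hx]
    filter_upwards [hsub.eventually hne] with x hx
    by_contra hx0
    obtain ⟨z, hz⟩ := (Submodule.mem_span_range_iff_exists_fun ℤ).1 x.2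
    refine hx (fun h => hx0 (Subtype.ext h)) ?_
    have h1 : L (σ x - fun j => 2 * Real.pi * (z j : ℝ)) = 0 := by
      rw [map_sub, hσ', ← hz, hb, sub_eq_zero]
      rfl
    have h2 := hL _ h1 1
    rw [one_smul] at h2
    simp only [Function.comp]
    rw [← sub_add_cancel (σ x) (fun j => 2 * Real.pi * (z j : ℝ)), torusExp_add,
      torusExp_two_pi_mul_int, mul_one, h2]
  have hZ : LinearIndependent ℤ b := by
    refine Fintype.linearIndependent_iff.2 fun z hz j => ?_
    by_contra hj
    -- With this order n, the j-th component of exp(2πz/n) is exp(±iπ) = -1, so the element is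
    -- nontrivial. A ℤ-relation z among the b_j would make it fix p.
    have hn : 2 * (z j).natAbs ≠ 0 := by omega
    have hz' : L (fun j => 2 * Real.pi * (z j : ℝ)) = 0 := by
      rw [hb] at hz
      exact congrArg Subtype.val hz
    have hfix := hL _ hz' (1 / (2 * (z j).natAbs : ℕ))
    refine hp z _ hn (fun h => ?_) (by convert hfix using 3; funext i; simp; ring)
    have h1 := congrFun h j
    obtain ⟨k, hk⟩ := Circle.exp_eq_one.1 h1
    have h0 : ((2 * (z j).natAbs : ℕ) : ℝ) ≠ 0 := by exact_mod_cast hn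
    have h2 : (z j : ℝ) = k * (2 * (z j).natAbs : ℕ) := by
      field_simp at hk
      linarith
    have h3 : z j = k * (2 * (z j).natAbs : ℕ) := by
      rw [← Int.cast_inj (α := ℝ), Int.cast_mul, Int.cast_natCast]
      exact h2
    have h4 := congrArg Int.natAbs h3
    rw [Int.natAbs_mul, Int.natAbs_natCast] at h4
    rcases Nat.eq_zero_or_pos k.natAbs with h5 | h5
    · rw [h5] at h4; omega
    · nlinarith [Int.natAbs_pos.2 hj]
  -- For a discrete subgroup the rank over ℤ equals the dimension of the real span.
  have hR : LinearIndependent ℝ b := by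
    rw [linearIndependent_iff_card_eq_finrank_span, Real.finrank_eq_int_finrank_of_discrete hdisc]
    exact linearIndependent_iff_card_eq_finrank_span.1 hZ
  intro v hv
  have h1 : ∑ j, (v j / (2 * Real.pi)) • b j = L.rangeRestrict v := by
    simp only [b, ← map_smul, ← map_sum]
    congr 1
    funext j
    simp [Finset.sum_apply, Pi.single_apply]
  have h2 : L.rangeRestrict v = 0 := Subtype.ext hv
  funext j
  have h3 := Fintype.linearIndependent_iff.1 hR _ (h1.trans h2) j
  simpa [Real.pi_ne_zero] using h3

end SymplecticToric
end

/-! ### Conclusion. -/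

noncomputable section

namespace SymplecticToric

variable {m : ℕ} {M : Type*} [TopologicalSpace M] [ChartedSpace (Model m) M]
  [IsManifold 𝓘(ℝ, Model m) ∞ M] [MulAction (Torus m) M] (T : SymplecticToric m M)

theorem isOpen_interiorPart : IsOpen T.interiorPart :=
  isOpen_interior.preimage T.moment_smooth.continuous

theorem smul_mem_interiorPart (g : Torus m) (p : M) (hp : p ∈ T.interiorPart) :
    g • p ∈ T.interiorPart := by
  simpa only [interiorPart, mem_preimage, T.moment_invariant] using hp

/-- At such a point the K_i are independent, and by nondegeneracy of ω so are the dμ^j; hence the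
coefficients of ∑ C_ij K_i ⊗ dμ^j are determined. -/
theorem eq_zero_of_matShear_eq_zero (ξ : Module.Basis (Fin m) ℝ (TorusLie m))
    (C : Matrix (Fin m) (Fin m) ℝ) {p : M} (hp : ∀ v : TorusLie m, infAction v p = 0 → v = 0)
    (h : ∀ X : TanSp m p, T.matShear ξ C p X = 0) : C = 0 := by
  have hz : ∀ a : Fin m → ℝ, ∑ i, a i • ξ i = 0 → ∀ i, a i = 0 :=
    fun a ha => Fintype.linearIndependent_iff.1 ξ.linearIndependent a ha
  ext i j
  refine hz (fun j => C i j) (hp _ (T.sympl_nondegenerate p _ fun X => ?_)) j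
  rw [T.moment_hamiltonian, T.dfun_moment_sum, neg_eq_zero]
  refine hz (fun i => ∑ j, C i j * dfun (fun q => T.moment q (ξ j)) p X) (hp _ ?_) i
  have h1 := h X
  rw [matShear_apply] at h1
  rw [← infActionL_apply, map_sum, ← h1]
  exact Finset.sum_congr rfl fun i _ => by rw [map_smul, infActionL_apply]

end SymplecticToric

end

theorem corollary3p12 {m : ℕ} {M : Type*} [TopologicalSpace M] [T2Space M] [CompactSpace M]
    [ConnectedSpace M] [ChartedSpace (Model m) M] [IsManifold 𝓘(ℝ, Model m) ∞ M]
    [MulAction (Torus m) M] (T : SymplecticToric m M)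
    (ξ : Module.Basis (Fin m) ℝ (TorusLie m)) (c : T.AdmissibleCoords ξ)
    (J₀ : EndField m M) (hJ₀ : T.IsKahler J₀)
    (S : M → Matrix (Fin m) (Fin m) ℝ) (hS : ∀ p ∈ T.interiorPart, (S p).PosDef)
    (hJ₀S : ∀ p ∈ T.interiorPart, J₀ p = c.antiDiag S p)
    (C : Matrix (Fin m) (Fin m) ℝ) (hC : C.transpose = -C) :
    (∀ t : ℝ, T.IsDGKOn T.interiorPart (c.antiDiag fun p => S p + t • C)) ∧
    ∃ ε : ℝ, 0 < ε ∧ ∃ J : ℝ → EndField m M,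
      J 0 = J₀ ∧
      (∀ t : ℝ, |t| < ε → T.IsDGKOn univ (J t) ∧
        ∀ p ∈ T.interiorPart, J t p = c.antiDiag (fun q => S q + t • C) p) ∧
      (∀ X : VecField m M, SmoothVecOn univ X →
        ContMDiffOn (𝓘(ℝ, ℝ).prod 𝓘(ℝ, Model m)) (𝓘(ℝ, Model m).tangent) ∞
          (fun q : ℝ × M => (⟨q.2, J q.1 q.2 (X q.2)⟩ : TangentBundle 𝓘(ℝ, Model m) M))
          (Ioo (-ε) ε ×ˢ univ)) ∧
      (C ≠ 0 → ∀ t : ℝ, t ≠ 0 → |t| < ε → ¬ T.IsKahler (J t)) := by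
  have hdef : ∀ t : ℝ, ∀ p ∈ T.interiorPart,
      c.antiDiag (fun q => S q + t • C) p = T.deform ξ C J₀ t p := fun t p hp =>
    SymplecticToric.antiDiag_eq_deform c hJ₀ hp (hS p hp) (hJ₀S p hp) hC t
  -- The value ε = 1 is arbitrary: the deformation exists for all real t.
  refine ⟨fun t => T.isDGKOn_of_eq_deform ξ hC hJ₀ T.isOpen_interiorPart T.smul_mem_interiorPart t
    (hdef t), 1, one_pos, T.deform ξ C J₀, ?_, fun t _ => ⟨T.isDGKOn_of_eq_deform ξ hC hJ₀
    isOpen_univ (fun _ _ _ => mem_univ _) t fun _ _ => rfl, fun p hp => (hdef t p hp).symm⟩,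
    fun X hX => ?_, fun hC0 t ht _ hK => ?_⟩
  · funext p
    exact shearConj_zero _ _
  · have h2 : ContMDiff (𝓘(ℝ, ℝ).prod 𝓘(ℝ, Model m)) (𝓘(ℝ, Model m).tangent) ∞
        (fun q : ℝ × M => (⟨q.2, X q.2⟩ : TangentBundle 𝓘(ℝ, Model m) M)) :=
      (contMDiffOn_univ.1 hX).comp contMDiff_snd
    exact (ContMDiff.clm_bundle_apply (T.contMDiff_deform ξ hC hJ₀) h2).contMDiffOn
  · obtain ⟨p, hp⟩ := T.exists_infAction_injective
    exact hC0 (T.eq_zero_of_matShear_eq_zero ξ C hp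
      ((T.shearData ξ hC hJ₀ p).shear_eq_zero ht (hK.2.2.2.2 p)))
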